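/- **Setting.** Let $\mathcal M$ be a layered episodic MDP with finite state space $\mathcal S$ ($S=|\mathcal S|$), finite action space $\mathcal A$ ($A=|\mathcal A|$), horizon $H\ge 1$ and costs in $[0,1]$; $\mathcal S$ is partitioned into layers $\mathcal S_1,\dots,\mathcal S_H$, with the initial state in $\mathcal S_1$ and step-$t$ transitions leading into $\mathcal S_{t+1}$. For a stationary policy $\pi$ let $d_\pi$ be its average state occupancy distribution (the law of $s_t$ when $\pi$ is rolled out and $t$ is uniform in $\{1,\dots,H\}$), and $A_\pi(s,a)=Q_\pi(s,a)-V_\pi(s)$ its advantage function. Let $\pi^E:\mathcal S\to\mathcal A$ be a deterministic expert and $\mu>0$ such that $|A_{\pi^E}(s,a)|\le\mu$ for all $s,a$. The expert's feedback $\zeta_E:\mathcal S\times\mathcal A\to\mathbb R$ satisfies $A_{\pi^E}(s,a)\le\zeta_E(s,a)\le\mu\,\mathbf 1[a\ne\pi^E(s)]$ for all $s,a$; an annotation of $s$ is the vector $\zeta_E(s,\cdot)$. Let $\mathcal B$ be a set of $B\ge 2$ deterministic policies $h:\mathcal S\to\mathcal A$, and $\mathcal X\subset\mathcal S$ a separator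 set for it, with $X=|\mathcal X|$: any two distinct $h,h'\in\mathcal B$ differ at some $x\in\mathcal X$. A CSC oracle $\mathcal O$ for $\mathcal B$ maps every finite multiset $D$ of pairs $(x,\vec c)\in\mathcal S\times\mathbb R^{\mathcal A}$ to some $h\in\mathcal B$ that minimizes the average of $\vec c(h(x))$ over $D$. For a probability vector $u$ on $\mathcal B$ let $\pi_u(a\mid s)=\sum_{h\in\mathcal B:\,h(s)=a}u[h]$. **Algorithm (LOGGER-M with $K=1$).** Let $N\ge1$, $\delta\in(0,1]$, $$\eta=\frac1{\mu\sqrt{NA}}\Big(\frac{\ln B}{X}\Big)^{1/4},\qquad T=\left\lceil\frac{N\ln(6NS/\delta)}{\sqrt{X^3\ln B}}\right\rceil .$$ In each round $n=1,\dots,N$: (a) for $j=1,\dots,T$, draw fresh independent standard Gaussian vectors $\ell_{x}\in\mathbb R^{\mathcal A}$, $x\in\mathcal X$, and let $h_{n,j}\in\mathcal B$ be the answer of $\mathcal O$ on the multiset union of $D_1,\dots,D_{n-1}$ and $\{(x,\tfrac1\eta\ell_{x}):x\in\mathcal X\}$; let $u_n$ be the uniform mixture of $h_{n,1},\dots,h_{n,T}$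 and output $\pi_n=\pi_{u_n}$; (b) roll out $\pi_n$ to draw $s_n\sim d_{\pi_n}$, query the expert on $s_n$, and set $D_n=\{(s_n,\zeta_E(s_n,\cdot))\}$. **Theorem.** There is a universal constant $C$ such that in every such setting, with $F_n(\pi)=\mathbb E_{s\sim d_{\pi_n}}\mathbb E_{a\sim\pi(\cdot\mid s)}[\zeta_E(s,a)]$: 1. with probability at least $1-\delta$, $$\mathrm{SReg}_N(\mathcal B)=\sum_{n=1}^N F_n(\pi_n)-\min_{h\in\mathcal B}\sum_{n=1}^N F_n(h)\ \le\ C\,\mu\sqrt{NA\,\ln(e/\delta)}\,\big(X^3\ln B\big)^{1/4};$$ 2. in every run it queries exactly $N$ expert annotations; 3. in every run it calls $\mathcal O$ exactly $N\,T=N\left\lceil\frac{N\ln(6NS/\delta)}{\sqrt{X^3\ln B}}\right\rceil$ times, i.e. $\frac{N^2\ln(6NS/\delta)}{\sqrt{X^3\ln B}}$ times up to the rounding of $T$ to an integer. (For $\delta\le 1/2$, $\ln(e/\delta)$ in item 1 is of the same order as $\ln(1/\delta)$.) -/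

import Mathlib

open MeasureTheory ProbabilityTheory
open scoped ENNReal

noncomputable section

namespace COIL

/-- Expectation of a real function under a probability distribution on a finite set. -/
def expect {α : Type*} [Fintype α] (p : PMF α) (f : α → ℝ) : ℝ :=
  ∑ a, (p a).toReal * f a

/-- A stationary (randomized) policy. -/
abbrev Policy (S A : Type*) := S → PMF A

/-- The randomized policy that follows the deterministic policy `h`. -/
def detPolicy {S A : Type*} (h : S → A) : Policy S A := fun s => PMF.pure (h s)

/-- A layered episodic Markov decision process. Steps are numbered `0, …, horizon - 1`, and
`trans t` governs the move from step `t` to step `t + 1`; it is used only when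
`t + 1 < horizon`. -/
structure LayeredMDP (S A : Type*) where
  horizon : ℕ
  horizon_pos : 0 < horizon
  cost : S → A → ℝ
  cost_mem : ∀ s a, cost s a ∈ Set.Icc (0 : ℝ) 1
  initial : PMF S
  trans : ℕ → S → A → PMF S
  layer : S → Fin horizon
  initial_layer : ∀ s ∈ initial.support, (layer s : ℕ) = 0
  trans_layer : ∀ t, t + 1 < horizon → ∀ s a, ∀ s' ∈ (trans t s a).support,
    (layer s' : ℕ) = t + 1

namespace LayeredMDP

variable {S A : Type*} (M : LayeredMDP S A)

/-- The law of `k` consecutive state-action pairs from step `t` on, when the state at step `t`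
has law `p` and the policy `π` is followed. -/
def rollout (π : Policy S A) : (k : ℕ) → (t : ℕ) → (p : PMF S) → PMF (Fin k → S × A)
  | 0, _, _ => PMF.pure Fin.elim0
  | k + 1, t, p => p.bind fun s => (π s).bind fun a =>
      (rollout π k (t + 1) (M.trans t s a)).map fun τ => (Fin.cons (s, a) τ : Fin (k + 1) → S × A)

/-- The law of a whole episode under `π`. -/
def episode (π : Policy S A) : PMF (Fin M.horizon → S × A) :=
  M.rollout π M.horizon 0 M.initial

/-- The state occupancy distribution at step `t`. -/
def occupancyAt (π : Policy S A) (t : Fin M.horizon) : PMF S :=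
  (M.episode π).map fun τ => (τ t).1

/-- The average state occupancy distribution: the uniform mixture of the `occupancyAt π t`. -/
def occupancy (π : Policy S A) : PMF S :=
  haveI : Nonempty (Fin M.horizon) := ⟨⟨0, M.horizon_pos⟩⟩
  (PMF.uniformOfFintype (Fin M.horizon)).bind (M.occupancyAt π)

/-- Total cost of a piece of trajectory. -/
def totalCost {k : ℕ} (τ : Fin k → S × A) : ℝ := ∑ i, M.cost (τ i).1 (τ i).2

variable [Fintype S] [Fintype A]

/-- Value function: the expected cost of rolling out `π` from `s`, starting at the step of `s`. -/
def value (π : Policy S A) (s : S) : ℝ :=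
  expect (M.rollout π (M.horizon - M.layer s) (M.layer s) (PMF.pure s)) M.totalCost

/-- Action-value function: the cost of `(s, a)` plus the expected cost of the remaining steps. -/
def actionValue (π : Policy S A) (s : S) (a : A) : ℝ :=
  M.cost s a +
    expect (M.rollout π (M.horizon - (M.layer s + 1)) (M.layer s + 1) (M.trans (M.layer s) s a))
      M.totalCost

/-- Advantage function. -/
def advantage (π : Policy S A) (s : S) (a : A) : ℝ := M.actionValue π s a - M.value π s

/-- `μ`-recoverability of the pair `(M, π)`. -/
def Recoverable (π : Policy S A) (μ : ℝ) : Prop := ∀ s a, |M.advantage π s a| ≤ μ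

/-- The online loss `F` of a policy `π'` in a round in which the learner plays `π`:
the expected feedback `ζ` at states visited by `π` and actions chosen by `π'`. -/
def roundLoss (ζ : S → A → ℝ) (π π' : Policy S A) : ℝ :=
  expect (M.occupancy π) fun s => expect (π' s) (ζ s)

/-- Static regret of the sequence of policies `π` against the nonempty class `Bc`. -/
def staticRegret (ζ : S → A → ℝ) (Bc : Finset (S → A)) (hBc : Bc.Nonempty) {N : ℕ}
    (π : Fin N → Policy S A) : ℝ :=
  ∑ n, M.roundLoss ζ (π n) (π n) -
    Bc.inf' hBc fun h => ∑ n, M.roundLoss ζ (π n) (detPolicy h)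

end LayeredMDP

/-- The condition on the expert's feedback `ζ` for the deterministic expert `πE`:
`A^E(s, a) ≤ ζ(s, a) ≤ μ · 1[a ≠ πE(s)]`. -/
def ValidFeedback {S A : Type*} [Fintype S] [Fintype A] [DecidableEq A] (M : LayeredMDP S A)
    (πE : S → A) (μ : ℝ) (ζ : S → A → ℝ) : Prop :=
  ∀ s a, M.advantage (detPolicy πE) s a ≤ ζ s a ∧ ζ s a ≤ μ * (if a ≠ πE s then 1 else 0)

/-- A cost-sensitive example: a state together with a vector of costs of the actions. -/
abbrev Example (S A : Type*) := S × (A → ℝ)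

/-- A multiset of cost-sensitive examples. -/
abbrev Dataset (S A : Type*) := Multiset (Example S A)

/-- Empirical (average) cost of the deterministic policy `h` on a dataset. -/
def empiricalCost {S A : Type*} (D : Dataset S A) (h : S → A) : ℝ :=
  (D.map fun e => e.2 (h e.1)).sum / (Multiset.card D : ℝ)

/-- A cost-sensitive classification oracle for the class `Bc`: it returns a policy of `Bc` with
the smallest empirical cost on its input. -/
structure CSCOracle {S A : Type*} (Bc : Finset (S → A)) where
  answer : Dataset S A → Bc
  optimal : ∀ D, ∀ h ∈ Bc, empiricalCost D (answer D) ≤ empiricalCost D h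

/-- `Xc` is a separator set for `Bc`. -/
def IsSeparator {S A : Type*} (Bc : Finset (S → A)) (Xc : Finset S) : Prop :=
  ∀ h ∈ Bc, ∀ h' ∈ Bc, h ≠ h' → ∃ x ∈ Xc, h x ≠ h' x

/-- The mixed policy `π_u` for `u ∈ Δ(Bc)`: at every state it draws `h ∼ u` and plays `h`. -/
def mixedPolicy {S A : Type*} {Bc : Finset (S → A)} (u : PMF Bc) : Policy S A :=
  fun s => u.map fun h => h.1 s

/-- Resources used so far: expert annotations and calls to the classification oracle. -/
structure Usage where
  annotations : ℕ
  oracleCalls : ℕ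

/-- A randomized computation which keeps track of the resources that it uses. -/
def Metered (α : Type*) := Usage → PMF (α × Usage)

namespace Metered

/-- Return a value, at no cost. -/
def ret {α : Type*} (a : α) : Metered α := fun c => PMF.pure (a, c)

/-- Sequential composition. -/
def bind {α β : Type*} (x : Metered α) (f : α → Metered β) : Metered β :=
  fun c => PMF.bind (x c) fun y => f y.1 y.2

/-- Draw from a distribution, at no cost. -/
def sample {α : Type*} (p : PMF α) : Metered α := fun c => p.map fun a => (a, c)

/-- Run `f 0, f 1, …, f (k - 1)` one after the other and collect the results. -/
def loop {α : Type*} : (k : ℕ) → (Fin k → Metered α) → Metered (Fin k → α)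
  | 0, _ => ret Fin.elim0
  | k + 1, f => bind (f 0) fun a => bind (loop k fun i => f i.succ) fun v =>
      ret (Fin.cons a v : Fin (k + 1) → α)

end Metered

/-- Ask the expert for its feedback at the state `s`: one annotation. -/
def annotate {S A : Type*} (ζ : S → A → ℝ) (s : S) : Metered (A → ℝ) :=
  fun c => PMF.pure (ζ s, { c with annotations := c.annotations + 1 })

/-- Call the classification oracle: one call. -/
def callOracle {S A : Type*} {Bc : Finset (S → A)} (O : CSCOracle Bc) (D : Dataset S A) :
    Metered Bc :=
  fun c => PMF.pure (O.answer D, { c with oracleCalls := c.oracleCalls + 1 })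

/-- Draw one example: roll out `π` to obtain a state `s ∼ d_π` and ask the expert at `s`. -/
def drawExample {S A : Type*} (M : LayeredMDP S A) (ζ : S → A → ℝ) (π : Policy S A) :
    Metered (Example S A) :=
  Metered.bind (Metered.sample (M.occupancy π)) fun s =>
    Metered.bind (annotate ζ s) fun c => Metered.ret (s, c)

/-- Draw a dataset of `K` independent examples. -/
def drawDataset {S A : Type*} (M : LayeredMDP S A) (ζ : S → A → ℝ) (K : ℕ) (π : Policy S A) :
    Metered (Dataset S A) :=
  Metered.bind (Metered.loop K fun _ => drawExample M ζ π) fun e =>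
    Metered.ret (Finset.univ.val.map e)

/-- LOGGER with `n` rounds to go, after the datasets `past`. In every round the online linear
optimization algorithm `oloa`, which sees the previous linear losses through the datasets that
represent them and uses its fresh internal randomness `ω`, chooses `u ∈ Δ(Bc)`; then `K`
examples are drawn with the policy `π_u`. The output is the sequence of all chosen `u`. -/
def logger {S A Ω : Type*} {Bc : Finset (S → A)} (M : LayeredMDP S A) (ζ : S → A → ℝ) (K : ℕ)
    (oloa : Ω → List (Dataset S A) → Metered (PMF Bc)) :
    (n : ℕ) → (Fin n → Ω) → List (Dataset S A) → Metered (Fin n → PMF Bc)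
  | 0, _, _ => Metered.ret Fin.elim0
  | n + 1, ω, past =>
      Metered.bind (oloa (ω 0) past) fun u =>
      Metered.bind (drawDataset M ζ K (mixedPolicy u)) fun D =>
      Metered.bind (logger M ζ K oloa n (fun i => ω i.succ) (past ++ [D])) fun us =>
        Metered.ret (Fin.cons u us : Fin (n + 1) → PMF Bc)

/-- The Gaussian perturbations used in one call of MFTPL with sparsification parameter `T`. -/
abbrev Perturbation {S : Type*} (A : Type*) (Xc : Finset S) (T : ℕ) := Fin T → Xc → A → ℝ

/-- The perturbation set `{(x, (K/η) ℓ_x) : x ∈ Xc}`. -/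
def perturbationSet {S A : Type*} (Xc : Finset S) (η : ℝ) (K : ℕ) (l : Xc → A → ℝ) :
    Dataset S A :=
  Xc.attach.val.map fun x => (x.1, fun a => (K : ℝ) / η * l x a)

/-- MFTPL: call the oracle `T` times on the accumulated datasets together with a perturbation
set, and return the uniform mixture of the `T` answers. -/
def mftpl {S A : Type*} {Bc : Finset (S → A)} (O : CSCOracle Bc) (Xc : Finset S) (η : ℝ) (K : ℕ)
    (T : ℕ) [NeZero T] (l : Perturbation A Xc T) (past : List (Dataset S A)) :
    Metered (PMF Bc) :=
  Metered.bind (Metered.loop T fun j => callOracle O (past.sum + perturbationSet Xc η K (l j)))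
    fun h => Metered.ret ((PMF.uniformOfFintype (Fin T)).map h)

/-- LOGGER-M with `N` rounds: LOGGER composed with MFTPL, for given values `l` of all the Gaussian
perturbations. The remaining randomness is that of the interaction with the MDP. The result
consists of the chosen `u_1, …, u_N ∈ Δ(Bc)` and the resources used. -/
def loggerM {S A : Type*} {Bc : Finset (S → A)} (M : LayeredMDP S A) (ζ : S → A → ℝ)
    (O : CSCOracle Bc) (Xc : Finset S) (η : ℝ) (K T N : ℕ) [NeZero T]
    (l : Fin N → Perturbation A Xc T) : PMF ((Fin N → PMF Bc) × Usage) :=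
  logger M ζ K (mftpl O Xc η K T) N l [] ⟨0, 0⟩

/-- The joint law of all perturbations: independent standard Gaussians. -/
def perturbationLaw {S : Type*} (A : Type*) [Fintype A] (Xc : Finset S) (T N : ℕ) :
    Measure (Fin N → Perturbation A Xc T) :=
  Measure.pi fun _ => Measure.pi fun _ => Measure.pi fun _ => Measure.pi fun _ => gaussianReal 0 1

/-- The probability, over the perturbations and the interaction with the MDP, that the result of
LOGGER-M lies in `E`. -/
def loggerMProb {S A : Type*} [Fintype A] {Bc : Finset (S → A)} (M : LayeredMDP S A)
    (ζ : S → A → ℝ) (O : CSCOracle Bc) (Xc : Finset S) (η : ℝ) (K T N : ℕ) [NeZero T]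
    (E : Set ((Fin N → PMF Bc) × Usage)) : ℝ≥0∞ :=
  ∫⁻ l, (loggerM M ζ O Xc η K T N l).toOuterMeasure E ∂(perturbationLaw A Xc T N)

/-- The learning rate `η = (ln B / X)^{1/4} / (μ √(N A))`. -/
def learningRate (μ : ℝ) (N A X B : ℕ) : ℝ :=
  1 / (μ * √((N : ℝ) * A)) * (Real.log B / X) ^ (1 / 4 : ℝ)

/-- The sparsification parameter `N ln(2NS/δ) / √(X³ ln B)`, rounded up to an integer. -/
def sparsification (N S X B : ℕ) (δ : ℝ) : ℕ :=
  ⌈(N : ℝ) * Real.log (2 * N * S / δ) / √((X : ℝ) ^ 3 * Real.log B)⌉₊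

end COIL

end

/-!
The regret bound rests on two facts about the oracle's answer `leader` on the annotated states and
one Gaussian perturbation, viewed as a random element of the class `Bc`.

*Stability* (`exists_leader_ne_subset`). If one more example changes the answer, then the answer
changes at a state `x` of the separator, away from some action `a`. Given all other coordinates of
the perturbation, this confines the coordinate `(x, a)` to a set of diameter `2 η μ`. As the
Gaussian density is below one, the answer changes with probability at most `2 η μ X A`.

*Be the leader* (`expect_leaderLaw_le`). The expected optimal value of the perturbed problem is a
potential whose increments bound the expected feedback of the leader up to the stability error
`4 η μ² X A`. The potential telescopes. It starts at `-√(2 X ln B) / η` or above by the Gaussian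
maximal inequality (`neg_potential_nil_le`), and it ends below the total feedback of every `h` in
the class. This bounds, for every sequence of observed states, the regret of the randomized leader
on the observed feedback. The learning rate `η` balances the two error terms.

Ties have probability zero because the class has a separator, so the answers are measurable up to
null sets, whatever the tie-breaking of the oracle. Hence the Gaussian randomness can be integrated
out (`lintegral_logger`): LOGGER-M is an adaptive process `run` on a finite set, which in every
round draws `T` independent answers from the law of the leader and then a state.

For this process, the regret on the occupancy distributions differs from the one above by two
terms (`sum_roundRegret_le`). Replacing the law of the leader by `T` samples costs, by Hoeffding's
inequality and a union bound over states and rounds, at most `μ √(2 ln(2NS/δ) / T)` per round; this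
determines `T`. Replacing the mean over the state by the drawn state leaves a martingale, which is
controlled by an exponential supermartingale and a union bound over the class; it is of lower order
because `ln B ≤ X A` (`sqrt_log_le`). Both tail bounds are applied with `δ / 2`.

The counts of annotations and oracle calls hold in every run, by induction on the rounds.
-/

noncomputable section

namespace COIL

/-! ### Product measures and one-dimensional fibres -/

/-- If every section of `D` along the coordinate `i` has measure at most `c`, so has `D`. -/
lemma pi_le_of_update_le {ι : Type*} [Fintype ι] [DecidableEq ι] {α : ι → Type*}
    [∀ i, MeasurableSpace (α i)] (μ : ∀ i, Measure (α i)) [∀ i, IsProbabilityMeasure (μ i)]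
    {D : Set (∀ i, α i)} (hD : MeasurableSet D) (i : ι) {c : ℝ≥0∞}
    (h : ∀ x, μ i {t | Function.update x i t ∈ D} ≤ c) : Measure.pi μ D ≤ c := by
  have hne : Nonempty (∀ i, α i) := by
    by_contra hn
    rw [not_nonempty_iff] at hn
    have h1 : Measure.pi μ Set.univ = 1 := measure_univ
    rw [Set.eq_empty_of_isEmpty Set.univ, measure_empty] at h1
    exact zero_ne_one h1
  obtain ⟨x⟩ := hne
  rw [← lintegral_indicator_one hD, lintegral_eq_lmarginal_univ x,
    lmarginal_erase' (μ := μ) _ (measurable_one.indicator hD) (Finset.mem_univ i)]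
  calc _ ≤ (∫⋯∫⁻_(Finset.univ.erase i), (fun _ => c) ∂μ) x := by
        refine lmarginal_mono (fun y => ?_) x
        refine le_trans (le_of_eq ?_) (h y)
        exact lintegral_indicator_one (measurable_update y hD)
    _ = c := by simp [lmarginal]

lemma gaussianReal_le_ediam (s : Set ℝ) : gaussianReal 0 1 s ≤ Metric.ediam s := by
  rw [gaussianReal_apply _ one_ne_zero]
  calc _ ≤ ∫⁻ _ in s, 1 := by
        refine lintegral_mono fun x => ?_
        rw [gaussianPDF, ENNReal.ofReal_le_one, gaussianPDFReal]
        have h1 : (√(2 * Real.pi * ((1 : NNReal) : ℝ)))⁻¹ ≤ 1 := by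
          refine inv_le_one_of_one_le₀ (Real.one_le_sqrt.2 ?_)
          have := Real.pi_gt_three
          simp only [NNReal.coe_one]
          linarith
        have h2 : Real.exp (-(x - 0) ^ 2 / (2 * ((1 : NNReal) : ℝ))) ≤ 1 := by
          rw [Real.exp_le_one_iff]
          simp only [NNReal.coe_one]
          nlinarith [sq_nonneg (x - 0)]
        exact mul_le_one₀ h1 (Real.exp_nonneg _) h2
    _ = volume s := by simp
    _ ≤ _ := Real.volume_le_diam s

/-- The law of a single perturbation: independent standard Gaussians. -/
def gaussianLaw {S : Type*} (A : Type*) [Fintype A] (Xc : Finset S) : Measure (Xc → A → ℝ) :=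
  Measure.pi fun _ => Measure.pi fun _ => gaussianReal 0 1

instance {S : Type*} (A : Type*) [Fintype A] (Xc : Finset S) :
    IsProbabilityMeasure (gaussianLaw A Xc) := by
  unfold gaussianLaw; infer_instance

open Classical in
/-- A set whose sections in the single Gaussian coordinate `(x, a)` have diameter at most `d` has
probability at most `d`, since the standard Gaussian density is below one. -/
lemma gaussianLaw_le_of_section {S A : Type*} [Fintype A] {Xc : Finset S}
    {D : Set (Xc → A → ℝ)} (hD : MeasurableSet D) (x : Xc) (a : A) {d : ℝ}
    (h : ∀ l t t', Function.update l x (Function.update (l x) a t) ∈ D →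
      Function.update l x (Function.update (l x) a t') ∈ D → t' - t ≤ d) :
    gaussianLaw A Xc D ≤ ENNReal.ofReal d := by
  refine pi_le_of_update_le _ hD x fun l => ?_
  refine pi_le_of_update_le _ (measurable_update l hD) a fun v => ?_
  refine (gaussianReal_le_ediam _).trans (Metric.ediam_le fun t ht t' ht' => ?_)
  have key : ∀ s s', s ∈ {t | Function.update v a t ∈ {y | Function.update l x y ∈ D}} →
      s' ∈ {t | Function.update v a t ∈ {y | Function.update l x y ∈ D}} → s' - s ≤ d := by
    intro s s' hs hs'
    refine h (Function.update l x v) s s' ?_ ?_ <;> simpa using by assumption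
  rw [edist_dist, Real.dist_eq]
  refine ENNReal.ofReal_le_ofReal (abs_le.2 ⟨?_, ?_⟩)
  · have := key t t' ht ht'
    linarith
  · exact key t' t ht' ht

/-! ### The perturbed leader -/

section Leader

variable {S A : Type*} {Bc : Finset (S → A)}

/-- The total feedback collected by `h` on the observed states `w`, plus its perturbation. -/
def perturbedCost (ζ : S → A → ℝ) (Xc : Finset S) (η : ℝ) (w : List S) (l : Xc → A → ℝ)
    (h : S → A) : ℝ :=
  (w.map fun s => ζ s (h s)).sum + 1 / η * ∑ x : Xc, l x (h x)

/-- The datasets that LOGGER has accumulated after the states `w` were annotated, one per round. -/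
def pastData (ζ : S → A → ℝ) (w : List S) : List (Dataset S A) :=
  w.map fun s => {(s, ζ s)}

/-- The oracle's answer on the annotated states `w` and the perturbation `l`. -/
def leader (ζ : S → A → ℝ) (O : CSCOracle Bc) (Xc : Finset S) (η : ℝ) (w : List S)
    (l : Xc → A → ℝ) : Bc :=
  O.answer ((pastData ζ w).sum + perturbationSet Xc η 1 l)

variable (ζ : S → A → ℝ) (O : CSCOracle Bc) (Xc : Finset S) (η : ℝ)

lemma perturbedCost_append (w : List S) (s : S) (l : Xc → A → ℝ) (h : S → A) :
    perturbedCost ζ Xc η (w ++ [s]) l h = perturbedCost ζ Xc η w l h + ζ s (h s) := by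
  simp only [perturbedCost, List.map_append, List.map_cons, List.map_nil, List.sum_append,
    List.sum_cons, List.sum_nil]
  ring

lemma sum_map_eq_perturbedCost (w : List S) (l : Xc → A → ℝ) (h : S → A) :
    (((pastData ζ w).sum + perturbationSet Xc η 1 l).map fun e => e.2 (h e.1)).sum =
      perturbedCost ζ Xc η w l h := by
  rw [Multiset.map_add, Multiset.sum_add, perturbedCost]
  congr 1
  · induction w with
    | nil => simp [pastData]
    | cons s w ih =>
      simp only [pastData, List.map_cons, List.sum_cons] at ih ⊢
      rw [Multiset.map_add, Multiset.sum_add, ih]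
      simp
  · rw [perturbationSet, Multiset.map_map, Finset.mul_sum]
    simp only [Nat.cast_one]
    rfl

lemma perturbedCost_leader_le (w : List S) (l : Xc → A → ℝ) {h : S → A} (hh : h ∈ Bc) :
    perturbedCost ζ Xc η w l (leader ζ O Xc η w l) ≤ perturbedCost ζ Xc η w l h := by
  have h1 := O.optimal ((pastData ζ w).sum + perturbationSet Xc η 1 l) h hh
  have h2 := sum_map_eq_perturbedCost ζ Xc η w l
  unfold leader
  set D := (pastData ζ w).sum + perturbationSet Xc η 1 l with hD
  rw [← h2, ← h2]
  rcases Nat.eq_zero_or_pos (Multiset.card D) with h0 | h0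
  · rw [Multiset.card_eq_zero] at h0
    simp [h0]
  · exact (div_le_div_iff_of_pos_right (by exact_mod_cast h0)).1 h1

lemma measurable_perturbedCost [Fintype A] (w : List S) (h : S → A) :
    Measurable fun l => perturbedCost ζ Xc η w l h := by
  unfold perturbedCost
  fun_prop

open Classical in
/-- Moving the coordinate `(x, a)` of the perturbation changes the cost of exactly those `h` that
play `a` at `x`. -/
lemma perturbedCost_update (w : List S) (l : Xc → A → ℝ) (x : Xc) (a : A) (t : ℝ) (h : S → A) :
    perturbedCost ζ Xc η w (Function.update l x (Function.update (l x) a t)) h =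
      perturbedCost ζ Xc η w l h + 1 / η * (if h x = a then t - l x a else 0) := by
  have : ∑ y : Xc, (Function.update l x (Function.update (l x) a t)) y (h y) =
      ∑ y : Xc, l y (h y) + if h x = a then t - l x a else 0 := by
    have h2 : ∀ y : Xc, (Function.update l x (Function.update (l x) a t)) y (h y) =
        l y (h y) + if y = x then (if h x = a then t - l x a else 0) else 0 := by
      intro y
      by_cases hy : y = x
      · subst hy
        by_cases ha : h y = a
        · simp [ha]
        · simp [ha]
      · simp [hy]
    simp only [h2, Finset.sum_add_distrib, Finset.sum_ite_eq', Finset.mem_univ, if_true]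
  rw [perturbedCost, this, perturbedCost]
  ring

variable [Fintype A] {ζ Xc η}

lemma gaussianLaw_tie (hη : 0 < η) (w : List S) {h h' : S → A} {x : S} (hx : x ∈ Xc)
    (hne : h x ≠ h' x) :
    gaussianLaw A Xc {l | perturbedCost ζ Xc η w l h = perturbedCost ζ Xc η w l h'} = 0 := by
  classical
  have hm : MeasurableSet {l | perturbedCost ζ Xc η w l h = perturbedCost ζ Xc η w l h'} :=
    measurableSet_eq_fun (measurable_perturbedCost ..) (measurable_perturbedCost ..)
  have := gaussianLaw_le_of_section hm ⟨x, hx⟩ (h x) (d := 0) ?_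
  · simpa using this
  · intro l t t' ht ht'
    simp only [Set.mem_ofPred_eq, perturbedCost_update, if_true, hne.symm, if_false] at ht ht'
    have : 1 / η * (t' - t) = 0 := by linarith
    rcases mul_eq_zero.1 this with h0 | h0
    · exact absurd h0 (by positivity)
    · exact h0.le

/-- The oracle's tie-breaking is arbitrary, but ties have probability zero, so that the events
`{leader = h}` agree almost everywhere with the closed sets `{h is optimal}`. -/
lemma nullMeasurableSet_leader (hη : 0 < η) (hX : IsSeparator Bc Xc) (w : List S) (h : Bc) :
    NullMeasurableSet {l | leader ζ O Xc η w l = h} (gaussianLaw A Xc) := by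
  have hm : MeasurableSet {l | ∀ h' ∈ Bc,
      perturbedCost ζ Xc η w l h ≤ perturbedCost ζ Xc η w l h'} := by
    have : {l | ∀ h' ∈ Bc, perturbedCost ζ Xc η w l h ≤ perturbedCost ζ Xc η w l h'} =
        ⋂ h' ∈ Bc, {l | perturbedCost ζ Xc η w l h ≤ perturbedCost ζ Xc η w l h'} := by
      ext; simp
    rw [this]
    exact Finset.measurableSet_biInter _ fun h' _ =>
      measurableSet_le (measurable_perturbedCost ..) (measurable_perturbedCost ..)
  refine hm.nullMeasurableSet.congr ?_
  have hz : ∀ᵐ l ∂(gaussianLaw A Xc), ∀ h' : Bc, h' ≠ h →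
      perturbedCost ζ Xc η w l h ≠ perturbedCost ζ Xc η w l h' := by
    rw [ae_all_iff]
    intro h'
    by_cases hh : h' = h
    · simp [hh]
    · obtain ⟨x, hx, hne⟩ := hX h h.2 h' h'.2 fun he => hh (Subtype.ext he.symm)
      filter_upwards [measure_eq_zero_iff_ae_notMem.1 (gaussianLaw_tie (ζ := ζ) hη w hx hne)]
        with l hl _ using hl
  filter_upwards [hz] with l hl
  refine propext ⟨fun ho => ?_, ?_⟩
  · by_contra hne
    exact hl _ hne (le_antisymm (ho _ (Subtype.prop _))
      (perturbedCost_leader_le ζ O Xc η w l h.2))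
  · rintro (rfl : _ = _)
    exact fun h' hh' => perturbedCost_leader_le ζ O Xc η w l hh'

/-- Stability of the perturbed leader: one more example changes the answer only with small
probability. If the answer changes at `x` away from the action `a`, then the coordinate `(x, a)`
of the perturbation lies, given the other ones, in a set of diameter `2 η μ`. The event is enlarged
to a measurable one. -/
lemma exists_leader_ne_subset {μ : ℝ} (hη : 0 < η) (hζ : ∀ s a, |ζ s a| ≤ μ)
    (hX : IsSeparator Bc Xc) (w : List S) (s : S) :
    ∃ D : Set (Xc → A → ℝ), MeasurableSet D ∧
      (∀ l, leader ζ O Xc η w l ≠ leader ζ O Xc η (w ++ [s]) l → l ∈ D) ∧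
      gaussianLaw A Xc D ≤
        ENNReal.ofReal ((Xc.card : ℝ) * Fintype.card A * (2 * η * μ)) := by
  classical
  let opt (v : List S) (h : Bc) : Set (Xc → A → ℝ) :=
    ⋂ h' : Bc, {l | perturbedCost ζ Xc η v l h ≤ perturbedCost ζ Xc η v l h'}
  have hopt : ∀ v h, MeasurableSet (opt v h) := fun v h => MeasurableSet.iInter fun h' =>
    measurableSet_le (measurable_perturbedCost ..) (measurable_perturbedCost ..)
  let E (x : Xc) (a : A) : Set (Xc → A → ℝ) :=
    ⋃ p : {p : Bc × Bc // p.1.1 x = a ∧ p.2.1 x ≠ a}, opt w p.1.1 ∩ opt (w ++ [s]) p.1.2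
  have hE : ∀ x a, MeasurableSet (E x a) := fun x a =>
    MeasurableSet.iUnion fun p => (hopt _ _).inter (hopt _ _)
  have hμ : ∀ x a, gaussianLaw A Xc (E x a) ≤ ENNReal.ofReal (2 * η * μ) := by
    intro x a
    refine gaussianLaw_le_of_section (hE x a) x a fun l t t' ht ht' => ?_
    simp only [E, opt, Set.mem_iUnion, Set.mem_inter_iff, Set.mem_iInter, Set.mem_ofPred_eq,
      perturbedCost_update, perturbedCost_append] at ht ht'
    obtain ⟨⟨⟨h₁, h₂⟩, hx₁, hx₂⟩, -, ho₂⟩ := ht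
    obtain ⟨⟨⟨k₁, k₂⟩, kx₁, kx₂⟩, ko₁, -⟩ := ht'
    simp only at hx₁ hx₂ kx₁ kx₂ ho₂ ko₁
    have e1 := ko₁ h₂
    have e2 := ho₂ k₁
    rw [if_pos kx₁, if_neg hx₂] at e1 e2
    have b1 := abs_le.1 (hζ s (k₁.1 s))
    have b2 := abs_le.1 (hζ s (h₂.1 s))
    have : 1 / η * (t' - t) ≤ 2 * μ := by linarith
    rw [one_div, inv_mul_le_iff₀ hη] at this
    linarith
  refine ⟨⋃ x, ⋃ a, E x a, MeasurableSet.iUnion fun x => MeasurableSet.iUnion fun a => hE x a,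
    fun l hl => ?_, ?_⟩
  · obtain ⟨x, hx, hne⟩ := hX _ (leader ζ O Xc η w l).2 _ (leader ζ O Xc η (w ++ [s]) l).2
      fun he => hl (Subtype.ext he)
    refine Set.mem_iUnion.2 ⟨⟨x, hx⟩, Set.mem_iUnion.2 ⟨(leader ζ O Xc η w l).1 x,
      Set.mem_iUnion.2 ⟨⟨(leader ζ O Xc η w l, leader ζ O Xc η (w ++ [s]) l), rfl, hne.symm⟩,
        ?_, ?_⟩⟩⟩ <;>
    exact Set.mem_iInter.2 fun h' => perturbedCost_leader_le ζ O Xc η _ l h'.2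
  · calc _ ≤ ∑ x : Xc, ∑ a : A, gaussianLaw A Xc (E x a) :=
          (measure_iUnion_fintype_le _ _).trans
            (Finset.sum_le_sum fun x _ => measure_iUnion_fintype_le _ _)
      _ ≤ ∑ _x : Xc, ∑ _a : A, ENNReal.ofReal (2 * η * μ) :=
          Finset.sum_le_sum fun x _ => Finset.sum_le_sum fun a _ => hμ x a
      _ = _ := by
          simp only [Finset.sum_const, Finset.card_univ, nsmul_eq_mul, Fintype.card_coe]
          rw [ENNReal.ofReal_mul (by positivity : (0 : ℝ) ≤ Xc.card * Fintype.card A),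
            ENNReal.ofReal_mul (Nat.cast_nonneg _), ENNReal.ofReal_natCast, ENNReal.ofReal_natCast]
          ring

end Leader

/-! ### Random elements of a finite set -/

section FiniteValued

variable {Ω β : Type*} [Fintype β]

lemma comp_eq_sum_indicator {R : Type*} [AddCommMonoid R] (f : Ω → β) (φ : β → Ω → R) (ω : Ω) :
    φ (f ω) ω = ∑ b, Set.indicator {ω | f ω = b} (φ b) ω := by
  classical
  simp [Set.indicator_apply]

variable [MeasurableSpace Ω] {γ : Measure Ω} {f : Ω → β}

lemma integral_comp_measurePreserving {P : Measure Ω} {ν : Measure ℝ} {f : Ω → ℝ}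
    (hf : MeasurePreserving f P ν) {g : ℝ → ℝ} (hg : Measurable g) :
    ∫ ω, g (f ω) ∂P = ∫ y, g y ∂ν := by
  rw [← hf.map_eq]
  exact (integral_map hf.measurable.aemeasurable hg.aestronglyMeasurable).symm

lemma integrable_comp_finite (hf : ∀ b, NullMeasurableSet {ω | f ω = b} γ) {φ : β → Ω → ℝ}
    (hφ : ∀ b, Integrable (φ b) γ) : Integrable (fun ω => φ (f ω) ω) γ := by
  simp_rw [comp_eq_sum_indicator f φ]
  exact integrable_finsetSum _ fun b _ => (hφ b).indicator₀ (hf b)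

lemma aemeasurable_comp_finite (hf : ∀ b, NullMeasurableSet {ω | f ω = b} γ)
    {φ : β → Ω → ℝ≥0∞} (hφ : ∀ b, AEMeasurable (φ b) γ) :
    AEMeasurable (fun ω => φ (f ω) ω) γ := by
  simp_rw [comp_eq_sum_indicator f φ]
  exact Finset.aemeasurable_fun_sum _ fun b _ => (hφ b).indicator₀ (hf b)

lemma lintegral_comp_finite (hf : ∀ b, NullMeasurableSet {ω | f ω = b} γ) (φ : β → ℝ≥0∞) :
    ∫⁻ ω, φ (f ω) ∂γ = ∑ b, γ {ω | f ω = b} * φ b := by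
  have := comp_eq_sum_indicator f fun b (_ : Ω) => φ b
  simp_rw [this]
  rw [lintegral_finsetSum' _ fun b _ => aemeasurable_const.indicator₀ (hf b)]
  refine Finset.sum_congr rfl fun b _ => ?_
  rw [lintegral_indicator₀ (hf b), setLIntegral_const, mul_comm]

lemma integral_comp_finite [IsFiniteMeasure γ] (hf : ∀ b, NullMeasurableSet {ω | f ω = b} γ)
    (φ : β → ℝ) :
    ∫ ω, φ (f ω) ∂γ = ∑ b, (γ {ω | f ω = b}).toReal * φ b := by
  have := comp_eq_sum_indicator f fun b (_ : Ω) => φ b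
  simp_rw [this]
  rw [integral_finsetSum _ fun b _ => (integrable_const _).indicator₀ (hf b)]
  refine Finset.sum_congr rfl fun b _ => ?_
  rw [integral_indicator₀ (hf b), setIntegral_const, smul_eq_mul, Measure.real]

lemma sum_measure_eq_one [IsProbabilityMeasure γ]
    (hf : ∀ b, NullMeasurableSet {ω | f ω = b} γ) : ∑ b, γ {ω | f ω = b} = 1 := by
  have := lintegral_comp_finite hf fun _ => 1
  simpa using this.symm

end FiniteValued

/-! ### Regret of the perturbed leader -/

section Regret

variable {S A : Type*} [Fintype A] {Bc : Finset (S → A)}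

/-- The law of the leader, that is, the element of `Δ(Bc)` from which MFTPL samples. -/
def leaderLaw (ζ : S → A → ℝ) (O : CSCOracle Bc) {Xc : Finset S} {η : ℝ} (hη : 0 < η)
    (hX : IsSeparator Bc Xc) (w : List S) : PMF Bc :=
  PMF.ofFintype (fun h => gaussianLaw A Xc {l | leader ζ O Xc η w l = h})
    (sum_measure_eq_one (nullMeasurableSet_leader O hη hX w))

variable {ζ : S → A → ℝ} {O : CSCOracle Bc} {Xc : Finset S} {η : ℝ}

lemma expect_leaderLaw (hη : 0 < η) (hX : IsSeparator Bc Xc) (w : List S) (φ : Bc → ℝ) :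
    expect (leaderLaw ζ O hη hX w) φ = ∫ l, φ (leader ζ O Xc η w l) ∂(gaussianLaw A Xc) :=
  (integral_comp_finite (nullMeasurableSet_leader O hη hX w) φ).symm

lemma measurePreserving_coordinate (x : Xc) (a : A) :
    MeasurePreserving (fun l : Xc → A → ℝ => l x a) (gaussianLaw A Xc) (gaussianReal 0 1) :=
  (measurePreserving_eval (fun _ : A => gaussianReal 0 1) a).comp
    (measurePreserving_eval (fun _ : Xc => Measure.pi fun _ : A => gaussianReal 0 1) x)

lemma integrable_coordinate (x : Xc) (a : A) :
    Integrable (fun l : Xc → A → ℝ => l x a) (gaussianLaw A Xc) :=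
  (measurePreserving_coordinate x a).integrable_comp_of_integrable
    (IsGaussian.integrable_id (μ := gaussianReal 0 1))

lemma integrable_perturbedCost (w : List S) (h : S → A) :
    Integrable (fun l => perturbedCost ζ Xc η w l h) (gaussianLaw A Xc) :=
  (integrable_const _).add
    ((integrable_finsetSum _ fun x _ => integrable_coordinate x (h x)).const_mul _)

lemma integral_perturbedCost (w : List S) (h : S → A) :
    ∫ l, perturbedCost ζ Xc η w l h ∂(gaussianLaw A Xc) = (w.map fun s => ζ s (h s)).sum := by
  unfold perturbedCost
  rw [integral_add (integrable_const _)
    ((integrable_finsetSum _ fun x _ => integrable_coordinate x (h x)).const_mul _),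
    integral_const_mul, integral_finsetSum _ fun x _ => integrable_coordinate x (h x)]
  have : ∀ x : Xc, ∫ l : Xc → A → ℝ, l x (h x) ∂(gaussianLaw A Xc) = 0 := fun x => by
    rw [integral_comp_measurePreserving (measurePreserving_coordinate x (h x)) measurable_id']
    exact integral_id_gaussianReal
  simp [this]

variable (ζ O Xc η) in
/-- The expected optimal value of the perturbed problem. Its increments dominate, up to the
stability error, the expected feedback of the leader. -/
def potential (w : List S) : ℝ :=
  ∫ l, perturbedCost ζ Xc η w l (leader ζ O Xc η w l) ∂(gaussianLaw A Xc)

lemma integrable_perturbedCost_leader (hη : 0 < η) (hX : IsSeparator Bc Xc) (v w : List S) :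
    Integrable (fun l => perturbedCost ζ Xc η v l (leader ζ O Xc η w l)) (gaussianLaw A Xc) :=
  integrable_comp_finite (φ := fun (h : Bc) l => perturbedCost ζ Xc η v l h)
    (nullMeasurableSet_leader O hη hX w) fun h => integrable_perturbedCost v h.1

lemma potential_le (hη : 0 < η) (hX : IsSeparator Bc Xc) (w : List S) {h : S → A} (hh : h ∈ Bc) :
    potential ζ O Xc η w ≤ (w.map fun s => ζ s (h s)).sum := by
  rw [← integral_perturbedCost (η := η) (Xc := Xc)]
  exact integral_mono (integrable_perturbedCost_leader hη hX w w) (integrable_perturbedCost w h)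
    fun l => perturbedCost_leader_le ζ O Xc η w l hh

/-- One step of the be-the-leader argument. The leader with foresight of `s` pays at most the
increment of the potential, and by stability it rarely differs from the leader. -/
lemma expect_leaderLaw_le {μ : ℝ} (hη : 0 < η) (hX : IsSeparator Bc Xc)
    (hζ : ∀ s a, |ζ s a| ≤ μ) (hμ : 0 ≤ μ) (w : List S) (s : S) :
    expect (leaderLaw ζ O hη hX w) (fun h => ζ s (h.1 s)) ≤
      potential ζ O Xc η (w ++ [s]) - potential ζ O Xc η w +
        4 * η * μ ^ 2 * Xc.card * Fintype.card A := by
  obtain ⟨D, hD, hsub, hle⟩ := exists_leader_ne_subset (O := O) hη hζ hX w s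
  rw [expect_leaderLaw]
  have i0 : ∀ v, Integrable (fun l => ζ s ((leader ζ O Xc η v l).1 s)) (gaussianLaw A Xc) :=
    fun v => integrable_comp_finite (φ := fun (h : Bc) _ => ζ s (h.1 s))
      (nullMeasurableSet_leader O hη hX v) fun h => integrable_const _
  have iD : Integrable (D.indicator fun _ => 2 * μ) (gaussianLaw A Xc) :=
    (integrable_const _).indicator hD
  have h1 : ∫ l, ζ s ((leader ζ O Xc η w l).1 s) ∂(gaussianLaw A Xc) ≤
      ∫ l, (perturbedCost ζ Xc η (w ++ [s]) l (leader ζ O Xc η (w ++ [s]) l) -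
        perturbedCost ζ Xc η w l (leader ζ O Xc η w l) + D.indicator (fun _ => 2 * μ) l)
          ∂(gaussianLaw A Xc) := by
    refine integral_mono (i0 w) (((integrable_perturbedCost_leader hη hX _ _).sub
      (integrable_perturbedCost_leader hη hX _ _)).add iD) fun l => ?_
    have h2 := perturbedCost_leader_le ζ O Xc η w l (leader ζ O Xc η (w ++ [s]) l).2
    simp only [perturbedCost_append]
    have h3 : ζ s ((leader ζ O Xc η w l).1 s) - ζ s ((leader ζ O Xc η (w ++ [s]) l).1 s) ≤
        D.indicator (fun _ => 2 * μ) l := by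
      by_cases he : leader ζ O Xc η w l = leader ζ O Xc η (w ++ [s]) l
      · rw [he, sub_self]
        exact Set.indicator_nonneg (fun _ _ => by positivity) l
      · rw [Set.indicator_of_mem (hsub l he)]
        have b1 := abs_le.1 (hζ s ((leader ζ O Xc η w l).1 s))
        have b2 := abs_le.1 (hζ s ((leader ζ O Xc η (w ++ [s]) l).1 s))
        linarith
    linarith
  rw [integral_add (f := fun l => perturbedCost ζ Xc η (w ++ [s]) l
      (leader ζ O Xc η (w ++ [s]) l) - perturbedCost ζ Xc η w l (leader ζ O Xc η w l))
      ((integrable_perturbedCost_leader hη hX _ _).sub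
        (integrable_perturbedCost_leader hη hX _ _)) iD,
    integral_sub (integrable_perturbedCost_leader hη hX _ _)
      (integrable_perturbedCost_leader hη hX _ _), integral_indicator hD, setIntegral_const,
    smul_eq_mul] at h1
  have h4 : (gaussianLaw A Xc).real D ≤ (Xc.card : ℝ) * Fintype.card A * (2 * η * μ) :=
    ENNReal.toReal_le_of_le_ofReal (by positivity) hle
  have h5 := mul_le_mul_of_nonneg_right h4 (by positivity : 0 ≤ 2 * μ)
  unfold potential
  linarith

lemma integral_exp_perturbation (h : S → A) (t : ℝ) :
    ∫ l : Xc → A → ℝ, Real.exp (t * ∑ x : Xc, l x (h x)) ∂(gaussianLaw A Xc) =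
      Real.exp (Xc.card * (t ^ 2 / 2)) := by
  have h1 : ∀ x : Xc, ∫ v : A → ℝ, Real.exp (t * v (h x)) ∂(Measure.pi fun _ => gaussianReal 0 1) =
      Real.exp (t ^ 2 / 2) := fun x => by
    refine (integral_comp_measurePreserving (g := fun y : ℝ => Real.exp (t * y))
      (measurePreserving_eval (fun _ : A => gaussianReal 0 1) (h x)) (by fun_prop)).trans ?_
    have := congrFun (mgf_id_gaussianReal (μ := 0) (v := 1)) t
    simpa [mgf] using this
  simp_rw [Finset.mul_sum, Real.exp_sum]
  rw [gaussianLaw, integral_fintype_prod_eq_prod (fun (x : Xc) (v : A → ℝ) =>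
    Real.exp (t * v (h x)))]
  simp only [h1, Finset.prod_const, Finset.card_univ, Fintype.card_coe]
  rw [← Real.exp_nat_mul]

/-- The Gaussian maximal inequality for the perturbations of the `B` policies, each of which has
variance `X`. -/
lemma neg_potential_nil_le (hη : 0 < η) (hX : IsSeparator Bc Xc) (hB : 2 ≤ Bc.card)
    (hXc : 0 < Xc.card) :
    -potential ζ O Xc η [] ≤ 1 / η * √(2 * Xc.card * Real.log Bc.card) := by
  set X : ℝ := (Xc.card : ℝ) with hXdef
  set L : ℝ := Real.log (Bc.card : ℝ) with hL
  have hX0 : 0 < X := Nat.cast_pos.2 hXc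
  have hB1 : (1 : ℝ) < Bc.card := by exact_mod_cast hB
  have hL0 : 0 < L := Real.log_pos hB1
  set t : ℝ := √(2 * L / X) with ht
  have ht0 : 0 < t := Real.sqrt_pos.2 (by positivity)
  have ht2 : t ^ 2 = 2 * L / X := Real.sq_sqrt (by positivity)
  let P (h : Bc) (l : Xc → A → ℝ) : ℝ := ∑ x : Xc, l x (h.1 x)
  have iP : Integrable (fun l => P (leader ζ O Xc η [] l) l) (gaussianLaw A Xc) :=
    integrable_comp_finite (nullMeasurableSet_leader O hη hX [])
      fun h => integrable_finsetSum _ fun x _ => integrable_coordinate x (h.1 x)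
  have iE : ∀ h : Bc, Integrable (fun l => Real.exp (-t * P h l)) (gaussianLaw A Xc) := fun h => by
    refine Integrable.of_integral_ne_zero ?_
    rw [integral_exp_perturbation]
    exact (Real.exp_pos _).ne'
  have hpot : potential ζ O Xc η [] =
      1 / η * ∫ l, P (leader ζ O Xc η [] l) l ∂(gaussianLaw A Xc) := by
    rw [← integral_const_mul]
    simp [potential, perturbedCost, P]
  have key : -(t * ∫ l, P (leader ζ O Xc η [] l) l ∂(gaussianLaw A Xc)) ≤ 2 * L := by
    -- `y ≤ exp (y - 2 L) + 2 L - 1`, summed over all policies instead of the leader alone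
    have h1 : ∫ l, -(t * P (leader ζ O Xc η [] l) l) ∂(gaussianLaw A Xc) ≤
        ∫ l, (Real.exp (-(2 * L)) * (∑ h : Bc, Real.exp (-t * P h l)) + (2 * L - 1))
          ∂(gaussianLaw A Xc) := by
      refine integral_mono (iP.const_mul t).neg
        (((integrable_finsetSum _ fun h _ => iE h).const_mul _).add (integrable_const _))
        fun l => ?_
      have h2 := Real.add_one_le_exp (-t * P (leader ζ O Xc η [] l) l + -(2 * L))
      have h3 : Real.exp (-t * P (leader ζ O Xc η [] l) l) ≤ ∑ h : Bc, Real.exp (-t * P h l) :=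
        Finset.single_le_sum (f := fun h : Bc => Real.exp (-t * P h l))
          (fun _ _ => (Real.exp_pos _).le) (Finset.mem_univ _)
      rw [Real.exp_add] at h2
      have h4 := mul_le_mul_of_nonneg_right h3 (Real.exp_pos (-(2 * L))).le
      simp only
      linarith
    rw [integral_neg, integral_const_mul, integral_add
      ((integrable_finsetSum _ fun h _ => iE h).const_mul _) (integrable_const _),
      integral_const_mul, integral_finsetSum _ fun h _ => iE h] at h1
    have h5 : ∀ h : Bc, ∫ l, Real.exp (-t * P h l) ∂(gaussianLaw A Xc) = Real.exp L := fun h => by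
      rw [integral_exp_perturbation, neg_sq, ht2, ← hXdef]
      congr 1
      field_simp
    have h6 : Real.exp (-(2 * L)) * (Bc.card * Real.exp L) = 1 := by
      rw [← Real.exp_log (by linarith : (0 : ℝ) < Bc.card), ← hL, ← Real.exp_add, ← Real.exp_add]
      simp [two_mul]
    simp only [h5, Finset.sum_const, Finset.card_univ, Fintype.card_coe, nsmul_eq_mul, h6,
      integral_const, probReal_univ, smul_eq_mul] at h1
    linarith
  have h7 : √(2 * X * L) * t = 2 * L := by
    rw [ht, ← Real.sqrt_mul (by positivity)]
    have : 2 * X * L * (2 * L / X) = (2 * L) ^ 2 := by field_simp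
    rw [this, Real.sqrt_sq (by positivity)]
  have h8 : -∫ l, P (leader ζ O Xc η [] l) l ∂(gaussianLaw A Xc) ≤ √(2 * X * L) := by
    refine le_of_mul_le_mul_right ?_ ht0
    rw [h7]
    linarith
  rw [hpot]
  have := mul_le_mul_of_nonneg_left h8 (by positivity : 0 ≤ 1 / η)
  linarith

end Regret

/-! ### Expectations over adaptive finite processes -/

section AdaptiveProcess

/-- Expectation of a nonnegative extended real function. -/
def lexpect {α : Type*} (p : PMF α) (φ : α → ℝ≥0∞) : ℝ≥0∞ := ∑' a, p a * φ a

variable {α β : Type*}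

lemma lexpect_bind (p : PMF α) (f : α → PMF β) (φ : β → ℝ≥0∞) :
    lexpect (p.bind f) φ = lexpect p fun a => lexpect (f a) φ := by
  simp only [lexpect, PMF.bind_apply, ← ENNReal.tsum_mul_right, ← ENNReal.tsum_mul_left]
  rw [ENNReal.tsum_comm]
  simp only [mul_assoc]

lemma lexpect_pure (a : α) (φ : α → ℝ≥0∞) : lexpect (PMF.pure a) φ = φ a := by
  classical
  rw [lexpect, tsum_eq_single a]
  · simp
  · intro b hb
    simp [hb]

lemma lexpect_map (p : PMF α) (f : α → β) (φ : β → ℝ≥0∞) :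
    lexpect (p.map f) φ = lexpect p fun a => φ (f a) := by
  rw [← PMF.bind_pure_comp, lexpect_bind]
  simp only [Function.comp, lexpect_pure]

lemma lexpect_mono (p : PMF α) {φ ψ : α → ℝ≥0∞} (h : ∀ a, φ a ≤ ψ a) :
    lexpect p φ ≤ lexpect p ψ :=
  ENNReal.tsum_le_tsum fun a => mul_le_mul_right (h a) _

lemma lexpect_const (p : PMF α) (c : ℝ≥0∞) : lexpect p (fun _ => c) = c := by
  rw [lexpect, ENNReal.tsum_mul_right, p.tsum_coe, one_mul]

lemma lexpect_add (p : PMF α) (φ ψ : α → ℝ≥0∞) :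
    lexpect p (fun a => φ a + ψ a) = lexpect p φ + lexpect p ψ := by
  simp only [lexpect, mul_add, ENNReal.tsum_add]

lemma lexpect_const_mul (p : PMF α) (c : ℝ≥0∞) (φ : α → ℝ≥0∞) :
    lexpect p (fun a => c * φ a) = c * lexpect p φ := by
  simp only [lexpect, ← ENNReal.tsum_mul_left, mul_left_comm]

lemma lexpect_sum {ι : Type*} (p : PMF α) (s : Finset ι) (φ : ι → α → ℝ≥0∞) :
    lexpect p (fun a => ∑ i ∈ s, φ i a) = ∑ i ∈ s, lexpect p (φ i) := by
  classical
  induction s using Finset.induction with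
  | empty => simp [lexpect]
  | insert i s hi ih => simp only [Finset.sum_insert hi, lexpect_add, ih]

lemma lexpect_ofReal [Fintype α] (p : PMF α) {φ : α → ℝ} (h : ∀ a, 0 ≤ φ a) :
    lexpect p (fun a => ENNReal.ofReal (φ a)) = ENNReal.ofReal (expect p φ) := by
  rw [lexpect, tsum_fintype, expect,
    ENNReal.ofReal_sum_of_nonneg fun a _ => mul_nonneg ENNReal.toReal_nonneg (h a)]
  refine Finset.sum_congr rfl fun a _ => ?_
  rw [ENNReal.ofReal_mul ENNReal.toReal_nonneg, ENNReal.ofReal_toReal (p.apply_ne_top a)]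

lemma toOuterMeasure_eq_lexpect (p : PMF α) (E : Set α) :
    p.toOuterMeasure E = lexpect p (E.indicator 1) := by
  rw [PMF.toOuterMeasure_apply, lexpect]
  congr with a
  by_cases h : a ∈ E <;> simp [h]

variable {S : Type*}

/-- The law of `n` rounds of an adaptive process: given the states `w` seen so far, `b ∼ p w` is
chosen and then a new state `s ∼ q b` is seen. -/
def run (p : List S → PMF β) (q : β → PMF S) : (n : ℕ) → List S → PMF (Fin n → β × S)
  | 0, _ => PMF.pure Fin.elim0
  | n + 1, w => (p w).bind fun b => (q b).bind fun s =>
      (run p q n (w ++ [s])).map fun z => (Fin.cons (b, s) z : Fin (n + 1) → β × S)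

/-- The sum along a trajectory of a function of the past states, the choice and the new state. -/
def pathSum {R : Type*} [AddCommMonoid R] (f : List S → β → S → R) :
    (n : ℕ) → List S → (Fin n → β × S) → R
  | 0, _, _ => 0
  | n + 1, w, z => f w (z 0).1 (z 0).2 + pathSum f n (w ++ [(z 0).2]) fun i => z i.succ

lemma lexpect_run_succ (p : List S → PMF β) (q : β → PMF S) (n : ℕ) (w : List S)
    (φ : (Fin (n + 1) → β × S) → ℝ≥0∞) :
    lexpect (run p q (n + 1) w) φ = lexpect (p w) fun b => lexpect (q b) fun s =>
      lexpect (run p q n (w ++ [s])) fun z => φ (Fin.cons (b, s) z) := by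
  simp only [run, lexpect_bind, lexpect_map]

lemma pathSum_cons {R : Type*} [AddCommMonoid R] (f : List S → β → S → R) (n : ℕ) (w : List S)
    (b : β) (s : S) (z : Fin n → β × S) :
    pathSum f (n + 1) w (Fin.cons (b, s) z : Fin (n + 1) → β × S) =
      f w b s + pathSum f n (w ++ [s]) z := by
  simp [pathSum]

/-- The exponential supermartingale bound. -/
lemma lexpect_exp_pathSum_le (p : List S → PMF β) (q : β → PMF S) {f : List S → β → S → ℝ}
    {c : ℝ≥0∞} (h : ∀ w, lexpect (p w) (fun b => lexpect (q b) fun s =>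
      ENNReal.ofReal (Real.exp (f w b s))) ≤ c) (n : ℕ) (w : List S) :
    lexpect (run p q n w) (fun z => ENNReal.ofReal (Real.exp (pathSum f n w z))) ≤ c ^ n := by
  induction n generalizing w with
  | zero => simp [run, lexpect_pure, pathSum]
  | succ n ih =>
    rw [lexpect_run_succ]
    simp only [pathSum_cons, Real.exp_add, ENNReal.ofReal_mul (Real.exp_pos _).le,
      lexpect_const_mul]
    calc _ ≤ lexpect (p w) fun b => lexpect (q b) fun s =>
            c ^ n * ENNReal.ofReal (Real.exp (f w b s)) := by
          refine lexpect_mono _ fun b => lexpect_mono _ fun s => ?_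
          rw [mul_comm]
          exact mul_le_mul_left (ih _) _
      _ ≤ c ^ n * c := by
          simp only [lexpect_const_mul]
          exact mul_le_mul_right (h w) _
      _ = c ^ (n + 1) := (pow_succ c n).symm

lemma lexpect_pathSum_le (p : List S → PMF β) (q : β → PMF S) {f : List S → β → S → ℝ≥0∞}
    {c : ℝ≥0∞} (h : ∀ w, lexpect (p w) (fun b => lexpect (q b) fun s => f w b s) ≤ c)
    (n : ℕ) (w : List S) :
    lexpect (run p q n w) (fun z => pathSum f n w z) ≤ n * c := by
  induction n generalizing w with
  | zero => simp [run, lexpect_pure, pathSum]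
  | succ n ih =>
    rw [lexpect_run_succ]
    simp only [pathSum_cons, lexpect_add, lexpect_const]
    calc _ ≤ c + lexpect (p w) fun b => lexpect (q b) fun _ => (n : ℝ≥0∞) * c :=
          add_le_add (h w) (lexpect_mono _ fun b => lexpect_mono _ fun s => ih _)
      _ = _ := by
          simp only [lexpect_const]
          push_cast
          ring

end AdaptiveProcess

/-! ### LOGGER-M as an adaptive process -/

section Logger

variable {S A : Type*} {Bc : Finset (S → A)}

lemma loop_callOracle (O : CSCOracle Bc) (k : ℕ) (D : Fin k → Dataset S A) (c : Usage) :
    Metered.loop k (fun j => callOracle O (D j)) c =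
      PMF.pure (fun j => O.answer (D j), ⟨c.annotations, c.oracleCalls + k⟩) := by
  induction k generalizing c with
  | zero =>
    simp only [Metered.loop, Metered.ret, add_zero]
    congr 2
    funext j
    exact j.elim0
  | succ k ih =>
    simp only [Metered.loop, Metered.bind, Metered.ret, callOracle, PMF.pure_bind] at ih ⊢
    rw [ih, PMF.pure_bind]
    congr 2
    · funext j
      refine Fin.cases ?_ (fun i => ?_) j <;> simp
    · simp only [Usage.mk.injEq, true_and]
      ring

/-- The uniform mixture of the answers of the oracle. -/
def mixture {T : ℕ} [NeZero T] (hv : Fin T → Bc) : PMF Bc :=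
  (PMF.uniformOfFintype (Fin T)).map hv

variable (M : LayeredMDP S A) (ζ : S → A → ℝ) (O : CSCOracle Bc) (Xc : Finset S) (η : ℝ)
  (T : ℕ) [NeZero T]

lemma mftpl_apply (l : Perturbation A Xc T) (w : List S) (c : Usage) :
    mftpl O Xc η 1 T l (pastData ζ w) c =
      PMF.pure (mixture fun j => leader ζ O Xc η w (l j),
        ⟨c.annotations, c.oracleCalls + T⟩) := by
  rw [mftpl, Metered.bind, loop_callOracle, PMF.pure_bind]
  rfl

lemma drawDataset_one (π : Policy S A) (c : Usage) :
    drawDataset M ζ 1 π c = (M.occupancy π).map fun s =>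
      (({(s, ζ s)} : Dataset S A), ⟨c.annotations + 1, c.oracleCalls⟩) := by
  simp only [drawDataset, Metered.bind, Metered.loop, drawExample, Metered.sample, annotate,
    Metered.ret, PMF.pure_bind, PMF.bind_map, PMF.bind_bind, Function.comp_def]
  rw [← PMF.bind_pure_comp]
  congr with s

lemma pastData_append (w : List S) (s : S) :
    pastData ζ (w ++ [s]) = pastData ζ w ++ [{(s, ζ s)}] := by
  simp [pastData]

lemma logger_succ (n : ℕ) (l : Fin (n + 1) → Perturbation A Xc T) (w : List S) (c : Usage) :
    logger M ζ 1 (mftpl O Xc η 1 T) (n + 1) l (pastData ζ w) c =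
      (M.occupancy (mixedPolicy (mixture fun j => leader ζ O Xc η w (l 0 j)))).bind fun s =>
        (logger M ζ 1 (mftpl O Xc η 1 T) n (fun i => l i.succ) (pastData ζ (w ++ [s]))
          ⟨c.annotations + 1, c.oracleCalls + T⟩).map fun r =>
            ((Fin.cons (mixture fun j => leader ζ O Xc η w (l 0 j)) r.1 : Fin (n + 1) → PMF Bc),
              r.2) := by
  simp only [logger, Metered.bind, mftpl_apply, PMF.pure_bind, drawDataset_one,
    Function.comp_def, Metered.ret, pastData_append, PMF.bind_bind, ← PMF.bind_pure_comp]

/-- Every run of `n` rounds uses `n` annotations and `n T` calls of the oracle. -/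
lemma usage_of_mem_support (n : ℕ) (l : Fin n → Perturbation A Xc T) (w : List S) (c : Usage)
    (r) (hr : r ∈ (logger M ζ 1 (mftpl O Xc η 1 T) n l (pastData ζ w) c).support) :
    r.2.annotations = c.annotations + n ∧ r.2.oracleCalls = c.oracleCalls + n * T := by
  induction n generalizing w c with
  | zero =>
    simp only [logger, Metered.ret, PMF.mem_support_pure_iff] at hr
    simp [hr]
  | succ n ih =>
    rw [logger_succ, PMF.mem_support_bind_iff] at hr
    obtain ⟨s, -, hr⟩ := hr
    rw [PMF.mem_support_map_iff] at hr
    obtain ⟨r', hr', rfl⟩ := hr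
    obtain ⟨h1, h2⟩ := ih _ _ _ _ hr'
    simp only at h1 h2 ⊢
    rw [h1, h2]
    constructor <;> ring

variable [Fintype A] {ζ Xc η}

variable (ζ) in
/-- The law of the `T` independent answers of the oracle in a round. -/
def answersLaw (hη : 0 < η) (hX : IsSeparator Bc Xc) (w : List S) : PMF (Fin T → Bc) :=
  PMF.ofFintype (fun hv => ∏ j, leaderLaw ζ O hη hX w (hv j)) (by
    rw [← Fintype.sum_pow, (tsum_fintype _).symm.trans (leaderLaw ζ O hη hX w).tsum_coe, one_pow])

omit [NeZero T] in
lemma nullMeasurableSet_answers (hη : 0 < η) (hX : IsSeparator Bc Xc) (w : List S)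
    (hv : Fin T → Bc) :
    NullMeasurableSet {L : Perturbation A Xc T | (fun j => leader ζ O Xc η w (L j)) = hv}
      (Measure.pi fun _ => gaussianLaw A Xc) := by
  have : {L : Perturbation A Xc T | (fun j => leader ζ O Xc η w (L j)) = hv} =
      ⋂ j, (fun L : Perturbation A Xc T => L j) ⁻¹' {l | leader ζ O Xc η w l = hv j} := by
    ext L
    simp [funext_iff]
  rw [this]
  exact NullMeasurableSet.iInter fun j => (nullMeasurableSet_leader O hη hX w (hv j)).preimage
    (Measure.quasiMeasurePreserving_eval (fun _ : Fin T => gaussianLaw A Xc) j)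

omit [NeZero T] in
lemma measure_answers (hη : 0 < η) (hX : IsSeparator Bc Xc) (w : List S) (hv : Fin T → Bc) :
    Measure.pi (fun _ => gaussianLaw A Xc)
      {L : Perturbation A Xc T | (fun j => leader ζ O Xc η w (L j)) = hv} =
      answersLaw ζ O T hη hX w hv := by
  have : {L : Perturbation A Xc T | (fun j => leader ζ O Xc η w (L j)) = hv} =
      Set.pi Set.univ fun j => {l | leader ζ O Xc η w l = hv j} := by
    ext L
    simp [funext_iff]
  rw [this, Measure.pi_pi]
  rfl

variable (ζ) in
/-- The law of the answers and states in the rounds of LOGGER-M. -/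
abbrev runM (hη : 0 < η) (hX : IsSeparator Bc Xc) (n : ℕ) (w : List S) :
    PMF (Fin n → (Fin T → Bc) × S) :=
  run (answersLaw ζ O T hη hX) (fun hv => M.occupancy (mixedPolicy (mixture hv))) n w

lemma lintegral_logger [Fintype S] (hη : 0 < η) (hX : IsSeparator Bc Xc) (n : ℕ) (w : List S)
    (c : Usage) (E : Set (Fin n → PMF Bc)) :
    AEMeasurable (fun l => (logger M ζ 1 (mftpl O Xc η 1 T) n l (pastData ζ w) c).toOuterMeasure
      {r | r.1 ∈ E}) (perturbationLaw A Xc T n) ∧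
    ∫⁻ l, (logger M ζ 1 (mftpl O Xc η 1 T) n l (pastData ζ w) c).toOuterMeasure {r | r.1 ∈ E}
        ∂(perturbationLaw A Xc T n) =
      (runM M ζ O T hη hX n w).toOuterMeasure {z | (fun i => mixture (z i).1) ∈ E} := by
  induction n generalizing w c with
  | zero =>
    have : IsProbabilityMeasure (perturbationLaw A Xc T 0) := by
      unfold perturbationLaw; infer_instance
    simp only [logger, Metered.ret, runM, run, toOuterMeasure_eq_lexpect, lexpect_pure]
    refine ⟨aemeasurable_const, ?_⟩
    rw [lintegral_const, measure_univ, mul_one]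
    have : ∀ us us' : Fin 0 → PMF Bc, us ∈ E ↔ us' ∈ E := fun us us' => by
      rw [Subsingleton.elim us us']
    simp only [Set.indicator, Set.mem_ofPred_eq]
    classical exact if_congr (this _ _) rfl rfl
  | succ n ih =>
    let Q : Measure (Perturbation A Xc T) := Measure.pi fun _ => gaussianLaw A Xc
    let c' : Usage := ⟨c.annotations + 1, c.oracleCalls + T⟩
    let f (L : Perturbation A Xc T) : Fin T → Bc := fun j => leader ζ O Xc η w (L j)
    let E' (hv : Fin T → Bc) : Set (Fin n → PMF Bc) :=
      {us | (Fin.cons (mixture hv) us : Fin (n + 1) → PMF Bc) ∈ E}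
    let G (hv : Fin T → Bc) (l : Fin n → Perturbation A Xc T) : ℝ≥0∞ :=
      ∑ s, M.occupancy (mixedPolicy (mixture hv)) s *
        (logger M ζ 1 (mftpl O Xc η 1 T) n l (pastData ζ (w ++ [s])) c').toOuterMeasure
          {r | r.1 ∈ E' hv}
    have hF : ∀ l, (logger M ζ 1 (mftpl O Xc η 1 T) (n + 1) l (pastData ζ w) c).toOuterMeasure
        {r | r.1 ∈ E} = G (f (l 0)) fun i => l i.succ := fun l => by
      rw [logger_succ, PMF.toOuterMeasure_bind_apply, tsum_fintype]
      refine Finset.sum_congr rfl fun s _ => ?_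
      rw [PMF.toOuterMeasure_map_apply]
      rfl
    have hG : ∀ hv, AEMeasurable (G hv) (perturbationLaw A Xc T n) := fun hv =>
      Finset.aemeasurable_fun_sum _ fun s _ => ((ih (w ++ [s]) c' (E' hv)).1).const_mul _
    have hint : ∀ hv, ∫⁻ l, G hv l ∂(perturbationLaw A Xc T n) =
        ∑ s, M.occupancy (mixedPolicy (mixture hv)) s * (runM M ζ O T hη hX n
          (w ++ [s])).toOuterMeasure {z | (fun i => mixture (z i).1) ∈ E' hv} := fun hv => by
      rw [lintegral_finsetSum' _ fun s _ => ((ih (w ++ [s]) c' (E' hv)).1).const_mul _]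
      refine Finset.sum_congr rfl fun s _ => ?_
      rw [lintegral_const_mul'' _ (ih (w ++ [s]) c' (E' hv)).1, (ih (w ++ [s]) c' (E' hv)).2]
    have hf : ∀ hv, NullMeasurableSet {L | f L = hv} Q :=
      nullMeasurableSet_answers O T hη hX w
    have hmp : MeasurePreserving (MeasurableEquiv.piFinSuccAbove (fun _ => Perturbation A Xc T) 0)
        (perturbationLaw A Xc T (n + 1)) (Q.prod (perturbationLaw A Xc T n)) :=
      measurePreserving_piFinSuccAbove (fun _ : Fin (n + 1) => Q) 0
    have : SFinite (perturbationLaw A Xc T n) := by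
      unfold perturbationLaw; infer_instance
    have hae : AEMeasurable (fun p : Perturbation A Xc T × (Fin n → Perturbation A Xc T) =>
        G (f p.1) p.2) (Q.prod (perturbationLaw A Xc T n)) :=
      aemeasurable_comp_finite (f := fun p : Perturbation A Xc T × (Fin n → Perturbation A Xc T) =>
          f p.1) (φ := fun hv p => G hv p.2)
        (fun hv => (hf hv).preimage Measure.quasiMeasurePreserving_fst)
        fun hv => (hG hv).comp_quasiMeasurePreserving Measure.quasiMeasurePreserving_snd
    have hF' : (fun l => (logger M ζ 1 (mftpl O Xc η 1 T) (n + 1) l (pastData ζ w)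
        c).toOuterMeasure {r | r.1 ∈ E}) = (fun p : Perturbation A Xc T ×
          (Fin n → Perturbation A Xc T) => G (f p.1) p.2) ∘
            MeasurableEquiv.piFinSuccAbove (fun _ => Perturbation A Xc T) 0 := by
      funext l
      rw [hF]
      rfl
    rw [hF']
    refine ⟨hae.comp_quasiMeasurePreserving hmp.quasiMeasurePreserving, ?_⟩
    refine (hmp.lintegral_comp_emb (MeasurableEquiv.measurableEmbedding _)
      (fun p : Perturbation A Xc T × (Fin n → Perturbation A Xc T) => G (f p.1) p.2)).trans ?_
    rw [lintegral_prod _ hae]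
    simp only [hint]
    rw [lintegral_comp_finite hf fun hv => ∑ s, M.occupancy (mixedPolicy (mixture hv)) s *
      (runM M ζ O T hη hX n (w ++ [s])).toOuterMeasure
        {z | (fun i => mixture (z i).1) ∈ E' hv}, runM, run,
      PMF.toOuterMeasure_bind_apply, tsum_fintype]
    refine Finset.sum_congr rfl fun hv _ => ?_
    rw [measure_answers O T hη hX, PMF.toOuterMeasure_bind_apply, tsum_fintype]
    congr 1
    refine Finset.sum_congr rfl fun s _ => ?_
    rw [PMF.toOuterMeasure_map_apply]
    congr 2
    ext z
    simp only [E', Set.mem_ofPred_eq, Set.mem_preimage]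
    have : (fun i => mixture ((Fin.cons (hv, s) z : Fin (n + 1) → (Fin T → Bc) × S) i).1) =
        (Fin.cons (mixture hv) fun i => mixture (z i).1 : Fin (n + 1) → PMF Bc) := by
      funext i
      refine Fin.cases ?_ (fun i => ?_) i <;> simp
    rw [this]

end Logger

/-! ### Expectations over finite sets and Hoeffding's inequality -/

section Expect

variable {α β : Type*} [Fintype α] [Fintype β]

lemma sum_toReal_eq_one (p : PMF α) : ∑ a, (p a).toReal = 1 := by
  rw [← ENNReal.toReal_sum fun a _ => p.apply_ne_top a, (tsum_fintype _).symm.trans p.tsum_coe,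
    ENNReal.toReal_one]

lemma expect_mono (p : PMF α) {f g : α → ℝ} (h : ∀ a, f a ≤ g a) : expect p f ≤ expect p g :=
  Finset.sum_le_sum fun a _ => mul_le_mul_of_nonneg_left (h a) ENNReal.toReal_nonneg

lemma expect_const (p : PMF α) (c : ℝ) : expect p (fun _ => c) = c := by
  rw [expect, ← Finset.sum_mul, sum_toReal_eq_one, one_mul]

lemma expect_add (p : PMF α) (f g : α → ℝ) :
    expect p (fun a => f a + g a) = expect p f + expect p g := by
  simp only [expect, mul_add, Finset.sum_add_distrib]

lemma expect_sub (p : PMF α) (f g : α → ℝ) :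
    expect p (fun a => f a - g a) = expect p f - expect p g := by
  simp only [expect, mul_sub, Finset.sum_sub_distrib]

lemma expect_const_mul (p : PMF α) (c : ℝ) (f : α → ℝ) :
    expect p (fun a => c * f a) = c * expect p f := by
  simp only [expect, Finset.mul_sum, mul_left_comm]

lemma expect_sum {ι : Type*} (p : PMF α) (s : Finset ι) (f : ι → α → ℝ) :
    expect p (fun a => ∑ i ∈ s, f i a) = ∑ i ∈ s, expect p (f i) := by
  simp only [expect, Finset.mul_sum]
  exact Finset.sum_comm

lemma abs_expect_le (p : PMF α) {f : α → ℝ} {b : ℝ} (h : ∀ a, |f a| ≤ b) : |expect p f| ≤ b := by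
  rw [abs_le]
  constructor
  · rw [← expect_const p (-b)]
    exact expect_mono p fun a => (abs_le.1 (h a)).1
  · rw [← expect_const p b]
    exact expect_mono p fun a => (abs_le.1 (h a)).2

lemma expect_map (p : PMF α) (f : α → β) (φ : β → ℝ) :
    expect (p.map f) φ = expect p fun a => φ (f a) := by
  classical
  have : ∀ b, ((p.map f) b).toReal = ∑ a, if b = f a then (p a).toReal else 0 := fun b => by
    rw [PMF.map_apply, tsum_fintype, ENNReal.toReal_sum]
    · refine Finset.sum_congr rfl fun a _ => ?_
      split_ifs <;> rfl
    · intro a _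
      split_ifs
      · exact p.apply_ne_top a
      · exact ENNReal.zero_ne_top
  simp only [expect, this, Finset.sum_mul]
  rw [Finset.sum_comm]
  simp [ite_mul]

lemma expect_pure (a : α) (φ : α → ℝ) : expect (PMF.pure a) φ = φ a := by
  classical
  rw [expect, Finset.sum_eq_single a]
  · simp
  · intro b _ hb
    simp [hb]
  · simp

lemma expect_mixture {S A : Type*} {Bc : Finset (S → A)} {T : ℕ} [NeZero T] (hv : Fin T → Bc)
    (φ : Bc → ℝ) : expect (mixture hv) φ = (∑ j, φ (hv j)) / T := by
  rw [mixture, expect_map]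
  simp only [expect, PMF.uniformOfFintype_apply, Fintype.card_fin, ENNReal.toReal_inv,
    ENNReal.toReal_natCast]
  rw [← Finset.mul_sum, div_eq_inv_mul]

/-- Hoeffding's lemma on a finite set. -/
lemma expect_exp_le (p : PMF α) {f : α → ℝ} {b : ℝ} (hf : ∀ a, |f a| ≤ b) (t : ℝ) :
    expect p (fun a => Real.exp (t * (f a - expect p f))) ≤ Real.exp (t ^ 2 * b ^ 2 / 2) := by
  let : MeasurableSpace α := ⊤
  have hi : ∀ g : α → ℝ, ∫ a, g a ∂p.toMeasure = expect p g := fun g => by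
    rw [PMF.integral_eq_sum]
    rfl
  have h := (hasSubgaussianMGF_of_mem_Icc (μ := p.toMeasure) (X := f) (a := -b) (b := b)
    (measurable_from_top.aemeasurable) (ae_of_all _ fun a => abs_le.1 (hf a))).mgf_le t
  rw [mgf, hi f, hi] at h
  refine h.trans (le_of_eq ?_)
  congr 1
  simp only [NNReal.coe_pow, NNReal.coe_div, coe_nnnorm, Real.norm_eq_abs, NNReal.coe_ofNat,
    div_pow, sq_abs]
  ring

end Expect

/-! ### The regret of LOGGER-M -/

section LoggerRegret

variable {S A : Type*} [Fintype S] [Fintype A] {Bc : Finset (S → A)} (M : LayeredMDP S A)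
  (ζ : S → A → ℝ) (O : CSCOracle Bc) {Xc : Finset S} {η : ℝ} (T : ℕ) [NeZero T]
  (hη : 0 < η) (hX : IsSeparator Bc Xc)

/-- The expected feedback at `s` of a policy drawn from `u`. -/
def meanFeedback (u : PMF Bc) (s : S) : ℝ := expect u fun h => ζ s (h.1 s)

lemma roundLoss_mixedPolicy (π : Policy S A) (u : PMF Bc) :
    M.roundLoss ζ π (mixedPolicy u) = expect (M.occupancy π) (meanFeedback ζ u) := by
  unfold LayeredMDP.roundLoss mixedPolicy
  simp only [expect_map]
  rfl

lemma roundLoss_detPolicy (π : Policy S A) (h : S → A) :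
    M.roundLoss ζ π (detPolicy h) = expect (M.occupancy π) fun s => ζ s (h s) := by
  simp only [LayeredMDP.roundLoss, detPolicy, expect_pure]

/-- The instantaneous regret against `h` in a round with the oracle answers `hv`. -/
def roundRegret (h : S → A) (hv : Fin T → Bc) : ℝ :=
  M.roundLoss ζ (mixedPolicy (mixture hv)) (mixedPolicy (mixture hv)) -
    M.roundLoss ζ (mixedPolicy (mixture hv)) (detPolicy h)

/-- The answers `hv` are a bad sample of the law of the leader: at some state their mean feedback
exceeds that of the law by more than `ε`. -/
def BadSample (ε : ℝ) (w : List S) (hv : Fin T → Bc) : Prop :=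
  ∃ s, ε < meanFeedback ζ (mixture hv) s - meanFeedback ζ (leaderLaw ζ O hη hX w) s

open Classical in
/-- The indicator of a bad sample. -/
def badIndicator (ε : ℝ) (w : List S) (hv : Fin T → Bc) (_ : S) : ℝ≥0∞ :=
  if BadSample ζ O T hη hX ε w hv then 1 else 0

/-- The deviation, at the drawn state, of the leader's instantaneous regret against `h` from its
mean over the state, scaled by `t`. -/
def deviation (t : ℝ) (h : S → A) (w : List S) (hv : Fin T → Bc) (s : S) : ℝ :=
  t * (expect (M.occupancy (mixedPolicy (mixture hv)))
      (fun s' => meanFeedback ζ (leaderLaw ζ O hη hX w) s' - ζ s' (h s')) -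
    (meanFeedback ζ (leaderLaw ζ O hη hX w) s - ζ s (h s)))

variable {ζ}

omit [Fintype S] [Fintype A] in
lemma abs_meanFeedback_le {μ : ℝ} (hζ : ∀ s a, |ζ s a| ≤ μ) (u : PMF Bc) (s : S) :
    |meanFeedback ζ u s| ≤ μ :=
  abs_expect_le u fun h => hζ s (h.1 s)

lemma lexpect_exp_deviation_le {μ : ℝ} (hζ : ∀ s a, |ζ s a| ≤ μ) (t : ℝ) (h : S → A)
    (w : List S) :
    lexpect (answersLaw ζ O T hη hX w) (fun hv =>
      lexpect (M.occupancy (mixedPolicy (mixture hv))) fun s =>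
        ENNReal.ofReal (Real.exp (deviation M ζ O T hη hX t h w hv s))) ≤
      ENNReal.ofReal (Real.exp (2 * t ^ 2 * μ ^ 2)) := by
  refine (lexpect_mono _ fun hv => ?_).trans (lexpect_const (answersLaw ζ O T hη hX w) _).le
  rw [lexpect_ofReal _ fun s => (Real.exp_pos _).le]
  refine ENNReal.ofReal_le_ofReal ?_
  have hb : ∀ s, |meanFeedback ζ (leaderLaw ζ O hη hX w) s - ζ s (h s)| ≤ 2 * μ := fun s => by
    refine (abs_sub _ _).trans ?_
    have h1 := abs_meanFeedback_le hζ (leaderLaw ζ O hη hX w) s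
    have h2 := hζ s (h s)
    linarith
  have := expect_exp_le (M.occupancy (mixedPolicy (mixture hv))) hb (-t)
  refine (le_of_eq ?_).trans (this.trans (le_of_eq ?_))
  · congr with s
    rw [deviation]
    ring_nf
  · ring_nf

omit [Fintype S] [NeZero T] in
lemma expect_answersLaw_prod (w : List S) (e : Bc → ℝ) :
    expect (answersLaw ζ O T hη hX w) (fun hv => ∏ j, e (hv j)) =
      (expect (leaderLaw ζ O hη hX w) e) ^ T := by
  rw [expect, expect, Fintype.sum_pow]
  refine Finset.sum_congr rfl fun hv _ => ?_
  rw [Finset.prod_mul_distrib, answersLaw, PMF.ofFintype_apply, ENNReal.toReal_prod]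

/-- Hoeffding's inequality for the `T` answers, with a union bound over the states: the state drawn
afterwards depends on the answers. -/
lemma lexpect_badIndicator_le {μ ε : ℝ} (hμ : 0 < μ) (hζ : ∀ s a, |ζ s a| ≤ μ) (hε : 0 ≤ ε)
    (w : List S) :
    lexpect (answersLaw ζ O T hη hX w) (fun hv =>
      lexpect (M.occupancy (mixedPolicy (mixture hv))) fun s =>
        badIndicator ζ O T hη hX ε w hv s) ≤
      ENNReal.ofReal (Fintype.card S * Real.exp (-(T * ε ^ 2 / (2 * μ ^ 2)))) := by
  have hT : (0 : ℝ) < T := Nat.cast_pos.2 (NeZero.pos T)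
  set p := leaderLaw ζ O hη hX w with hp
  set t := ε / μ ^ 2 with ht
  have ht0 : 0 ≤ t := by positivity
  let F (s : S) (h : Bc) : ℝ := ζ s (h.1 s)
  have h1 : ∀ hv s', badIndicator ζ O T hη hX ε w hv s' ≤ ENNReal.ofReal
      (∑ s, Real.exp (-(t * T * ε)) * ∏ j, Real.exp (t * (F s (hv j) - expect p (F s)))) := by
    intro hv s'
    unfold badIndicator
    split_ifs with hbad
    · obtain ⟨s, hs⟩ := hbad
      rw [ENNReal.one_le_ofReal]
      refine le_trans ?_ (Finset.single_le_sum (f := fun s => Real.exp (-(t * T * ε)) *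
        ∏ j, Real.exp (t * (F s (hv j) - expect p (F s)))) (fun _ _ => by positivity)
        (Finset.mem_univ s))
      rw [← Real.exp_sum, ← Real.exp_add, Real.one_le_exp_iff, ← Finset.mul_sum,
        Finset.sum_sub_distrib, Finset.sum_const, Finset.card_univ, Fintype.card_fin,
        nsmul_eq_mul]
      have hs' : ε < (∑ j, F s (hv j)) / T - expect p (F s) := by
        rw [← expect_mixture]
        exact hs
      have h2 : T * ε ≤ (∑ j, F s (hv j)) - T * expect p (F s) := by
        have h3 := mul_le_mul_of_nonneg_left hs'.le hT.le
        rwa [mul_sub, mul_div_cancel₀ _ hT.ne'] at h3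
      have h4 := mul_le_mul_of_nonneg_left h2 ht0
      linarith
    · exact zero_le
  calc _ ≤ lexpect (answersLaw ζ O T hη hX w) fun hv => ENNReal.ofReal
        (∑ s, Real.exp (-(t * T * ε)) * ∏ j, Real.exp (t * (F s (hv j) - expect p (F s)))) :=
        lexpect_mono _ fun hv => (lexpect_mono _ (h1 hv)).trans (lexpect_const _ _).le
    _ ≤ _ := by
        rw [lexpect_ofReal _ fun hv => Finset.sum_nonneg fun s _ => by positivity]
        refine ENNReal.ofReal_le_ofReal ?_
        rw [expect_sum, ← nsmul_eq_mul]
        refine Finset.sum_le_card_nsmul _ _ _ fun s _ => ?_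
        rw [expect_const_mul, expect_answersLaw_prod O T hη hX w
          (fun h => Real.exp (t * (F s h - expect p (F s))))]
        have h5 := pow_le_pow_left₀ (Finset.sum_nonneg fun h _ => mul_nonneg
          ENNReal.toReal_nonneg (Real.exp_pos _).le)
          (expect_exp_le p (f := F s) (fun h => hζ s (h.1 s)) t) T
        refine (mul_le_mul_of_nonneg_left h5 (Real.exp_pos _).le).trans (le_of_eq ?_)
        rw [← Real.exp_nat_mul, ← Real.exp_add]
        congr 1
        rw [ht]
        field_simp
        ring

omit [Fintype S] in
lemma pathSum_badIndicator (ε : ℝ) (n : ℕ) (w : List S) (z : Fin n → (Fin T → Bc) × S) :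
    pathSum (badIndicator ζ O T hη hX ε) n w z = 0 ∨
      1 ≤ pathSum (badIndicator ζ O T hη hX ε) n w z := by
  induction n generalizing w with
  | zero => exact Or.inl rfl
  | succ n ih =>
    rw [pathSum]
    by_cases hb : BadSample ζ O T hη hX ε w (z 0).1
    · right
      rw [badIndicator, if_pos hb]
      exact le_self_add
    · rw [badIndicator, if_neg hb, zero_add]
      exact ih _ _

/-- Along a trajectory without bad samples, the regret is at most the sum of the deviations plus
deterministic terms; the potential telescopes. -/
lemma sum_roundRegret_le {μ : ℝ} (hμ : 0 ≤ μ) (hζ : ∀ s a, |ζ s a| ≤ μ) {ε t : ℝ} (ht : 0 ≤ t)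
    {h : S → A} (hh : h ∈ Bc) (n : ℕ) (w : List S) (z : Fin n → (Fin T → Bc) × S)
    (hz : pathSum (badIndicator ζ O T hη hX ε) n w z = 0) :
    t * ∑ i, roundRegret M ζ T h (z i).1 ≤ pathSum (deviation M ζ O T hη hX t h) n w z +
      t * (n * (ε + 4 * η * μ ^ 2 * Xc.card * Fintype.card A) +
        (w.map fun s => ζ s (h s)).sum - potential ζ O Xc η w) := by
  induction n generalizing w with
  | zero =>
    have := potential_le (ζ := ζ) (O := O) hη hX w hh
    simp only [Finset.univ_eq_empty, Finset.sum_empty, mul_zero, pathSum, zero_add, Nat.cast_zero,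
      zero_mul]
    exact mul_nonneg ht (by linarith)
  | succ n ih =>
    rw [pathSum, add_eq_zero] at hz
    obtain ⟨hz0, hz1⟩ := hz
    have hgood : ¬ BadSample ζ O T hη hX ε w (z 0).1 := fun hb => by
      rw [badIndicator, if_pos hb] at hz0
      exact one_ne_zero hz0
    simp only [BadSample, not_exists, not_lt] at hgood
    have h1 := ih _ _ hz1
    have h2 := expect_leaderLaw_le (O := O) hη hX hζ hμ w (z 0).2
    rw [Fin.sum_univ_succ, pathSum]
    have h3 : roundRegret M ζ T h (z 0).1 ≤ ε +
        expect (M.occupancy (mixedPolicy (mixture (z 0).1)))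
          (fun s' => meanFeedback ζ (leaderLaw ζ O hη hX w) s' - ζ s' (h s')) := by
      rw [roundRegret, roundLoss_mixedPolicy, roundLoss_detPolicy, ← expect_sub,
        ← expect_const (M.occupancy (mixedPolicy (mixture (z 0).1))) ε, ← expect_add]
      refine expect_mono _ fun s => ?_
      have := hgood s
      linarith
    have h4 : roundRegret M ζ T h (z 0).1 ≤ ε +
        (expect (M.occupancy (mixedPolicy (mixture (z 0).1)))
          (fun s' => meanFeedback ζ (leaderLaw ζ O hη hX w) s' - ζ s' (h s')) -
            (meanFeedback ζ (leaderLaw ζ O hη hX w) (z 0).2 - ζ (z 0).2 (h (z 0).2))) +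
        (potential ζ O Xc η (w ++ [(z 0).2]) - potential ζ O Xc η w +
          4 * η * μ ^ 2 * Xc.card * Fintype.card A - ζ (z 0).2 (h (z 0).2)) := by
      unfold meanFeedback at h3 ⊢
      linarith
    have h5 := mul_le_mul_of_nonneg_left h4 ht
    simp only [List.map_append, List.map_cons, List.map_nil, List.sum_append, List.sum_cons,
      List.sum_nil, add_zero] at h1
    rw [deviation]
    push_cast
    linarith

/-- The tail bound for the regret: a bad sample or a large sum of deviations is unlikely. -/
lemma one_le_prob_regret {μ : ℝ} (hμ : 0 < μ) (hζ : ∀ s a, |ζ s a| ≤ μ) {ε t : ℝ} (hε : 0 ≤ ε)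
    (ht : 0 < t) (R : ℝ) (n : ℕ) :
    1 ≤ (runM M ζ O T hη hX n []).toOuterMeasure {z | ∀ h ∈ Bc,
        ∑ i, roundRegret M ζ T h (z i).1 ≤ R +
          (n * (ε + 4 * η * μ ^ 2 * Xc.card * Fintype.card A) - potential ζ O Xc η [])} +
      (ENNReal.ofReal (n * (Fintype.card S * Real.exp (-(T * ε ^ 2 / (2 * μ ^ 2))))) +
        ENNReal.ofReal (Bc.card * (Real.exp (-(t * R)) * Real.exp (n * (2 * t ^ 2 * μ ^ 2))))) := by
  set E : Set (Fin n → (Fin T → Bc) × S) := {z | ∀ h ∈ Bc,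
        ∑ i, roundRegret M ζ T h (z i).1 ≤ R +
          (n * (ε + 4 * η * μ ^ 2 * Xc.card * Fintype.card A) - potential ζ O Xc η [])} with hE
  let P := runM M ζ O T hη hX n []
  let dev (h : S → A) (z : Fin n → (Fin T → Bc) × S) : ℝ :=
    pathSum (deviation M ζ O T hη hX t h) n [] z
  have key : ∀ z, 1 ≤ E.indicator 1 z + (pathSum (badIndicator ζ O T hη hX ε) n [] z +
      ∑ h ∈ Bc, ENNReal.ofReal (Real.exp (-(t * R))) * ENNReal.ofReal (Real.exp (dev h z))) := by
    intro z
    by_cases hz : z ∈ E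
    · rw [Set.indicator_of_mem hz]
      exact le_self_add
    · rw [Set.indicator_of_notMem hz, zero_add]
      rcases pathSum_badIndicator O T hη hX ε n [] z with h0 | h1
      · rw [h0, zero_add]
        simp only [hE, Set.mem_ofPred_eq, not_forall, not_le] at hz
        obtain ⟨h, hh, hlt⟩ := hz
        refine le_trans ?_ (Finset.single_le_sum (f := fun h => ENNReal.ofReal
          (Real.exp (-(t * R))) * ENNReal.ofReal (Real.exp (dev h z))) (fun _ _ => zero_le) hh)
        rw [← ENNReal.ofReal_mul (Real.exp_pos _).le, ← Real.exp_add, ENNReal.one_le_ofReal,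
          Real.one_le_exp_iff]
        have h2 := sum_roundRegret_le M O T hη hX hμ.le hζ ht.le hh n [] z h0
        have h3 := mul_le_mul_of_nonneg_left hlt.le ht.le
        simp only [List.map_nil, List.sum_nil, add_zero] at h2
        simp only [dev]
        linarith
      · exact h1.trans le_self_add
  calc (1 : ℝ≥0∞) = lexpect P fun _ => 1 := (lexpect_const P 1).symm
    _ ≤ lexpect P fun z => E.indicator 1 z + (pathSum (badIndicator ζ O T hη hX ε) n [] z +
      ∑ h ∈ Bc, ENNReal.ofReal (Real.exp (-(t * R))) * ENNReal.ofReal (Real.exp (dev h z))) :=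
        lexpect_mono _ key
    _ ≤ _ := by
      rw [lexpect_add, lexpect_add, lexpect_sum, toOuterMeasure_eq_lexpect]
      refine add_le_add le_rfl (add_le_add ?_ ?_)
      · rw [ENNReal.ofReal_mul (Nat.cast_nonneg _), ENNReal.ofReal_natCast]
        exact lexpect_pathSum_le _ _ (lexpect_badIndicator_le M O T hη hX hμ hζ hε) n []
      · rw [ENNReal.ofReal_mul (Nat.cast_nonneg _), ENNReal.ofReal_natCast, ← nsmul_eq_mul]
        refine Finset.sum_le_card_nsmul _ _ _ fun h _ => ?_
        rw [lexpect_const_mul, ENNReal.ofReal_mul (Real.exp_pos _).le, Real.exp_nat_mul,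
          ENNReal.ofReal_pow (Real.exp_pos _).le]
        exact mul_le_mul_right (lexpect_exp_pathSum_le _ _
          (lexpect_exp_deviation_le M O T hη hX hζ t h) n []) _

end LoggerRegret

/-! ### The choice of the parameters -/

section Parameters

lemma card_le_pow_of_isSeparator {S A : Type*} [Fintype A] {Bc : Finset (S → A)} {Xc : Finset S}
    (hX : IsSeparator Bc Xc) : Bc.card ≤ Fintype.card A ^ Xc.card := by
  classical
  have h := Finset.card_le_card_of_injOn (s := Bc) (t := (Finset.univ : Finset (Xc → A)))
    (fun h x => h x) (fun _ _ => Finset.mem_coe.2 (Finset.mem_univ _)) fun h hh h' hh' he => by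
      by_contra hne
      obtain ⟨x, hx, hxne⟩ := hX h hh h' hh' hne
      exact hxne (congrFun he ⟨x, hx⟩)
  simpa [Finset.card_univ, Fintype.card_fun, Fintype.card_coe] using h

lemma abs_le_of_validFeedback {S A : Type*} [Fintype S] [Fintype A] [DecidableEq A]
    {M : LayeredMDP S A} {πE : S → A} {μ : ℝ} {ζ : S → A → ℝ} (hμ : 0 < μ)
    (hr : M.Recoverable (detPolicy πE) μ) (hv : ValidFeedback M πE μ ζ) (s : S) (a : A) :
    |ζ s a| ≤ μ := by
  refine abs_le.2 ⟨(abs_le.1 (hr s a)).1.trans (hv s a).1, (hv s a).2.trans ?_⟩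
  split_ifs <;> linarith

variable {μ δ N A S X L V T η q : ℝ}

/-- With `ε = μ √(2 ln(2NS/δ) / T)` a bad sample occurs in `N` rounds with probability at most
`δ / 2`. -/
lemma prob_badSample_le (hμ : 0 < μ) (hδ : 0 < δ) (hδ1 : δ ≤ 1) (hN : 1 ≤ N) (hS : 1 ≤ S)
    (hT : 0 < T) :
    N * (S * Real.exp (-(T * (μ * √(2 * Real.log (2 * N * S / δ) / T)) ^ 2 / (2 * μ ^ 2)))) ≤
      δ / 2 := by
  have hNS : 1 ≤ N * S := one_le_mul_of_one_le_of_one_le hN hS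
  have h1 : 1 ≤ 2 * N * S / δ := by
    rw [le_div_iff₀ hδ]
    linarith
  have h0 : 0 ≤ Real.log (2 * N * S / δ) := Real.log_nonneg h1
  have h2 : T * (μ * √(2 * Real.log (2 * N * S / δ) / T)) ^ 2 / (2 * μ ^ 2) =
      Real.log (2 * N * S / δ) := by
    rw [mul_pow, Real.sq_sqrt (by positivity)]
    field_simp
  rw [h2, Real.exp_neg, Real.exp_log (by positivity)]
  refine le_of_eq ?_
  field_simp

/-- With `R = μ √(8 N ln(2B/δ))` and the optimal exponent `R / (4 N μ²)`, the sums of the deviations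
for the `B` policies exceed `R` with probability at most `δ / 2`. -/
lemma prob_deviation_le {B : ℝ} (hμ : 0 < μ) (hδ : 0 < δ) (hδ1 : δ ≤ 1) (hN : 1 ≤ N)
    (hB : 2 ≤ B) {R t : ℝ} (hR : R = μ * √(8 * N * Real.log (2 * B / δ)))
    (ht : t = R / (4 * N * μ ^ 2)) :
    B * (Real.exp (-(t * R)) * Real.exp (N * (2 * t ^ 2 * μ ^ 2))) ≤ δ / 2 := by
  have h1 : 1 ≤ 2 * B / δ := by
    rw [le_div_iff₀ hδ]
    linarith
  have h0 : 0 ≤ Real.log (2 * B / δ) := Real.log_nonneg h1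
  have hR2 : R ^ 2 = μ ^ 2 * (8 * N * Real.log (2 * B / δ)) := by
    rw [hR, mul_pow, Real.sq_sqrt (by positivity)]
  have h2 : -(t * R) + N * (2 * t ^ 2 * μ ^ 2) = -Real.log (2 * B / δ) := by
    have h3 : -(t * R) + N * (2 * t ^ 2 * μ ^ 2) = -(R ^ 2 / (8 * N * μ ^ 2)) := by
      rw [ht]
      field_simp
      ring
    rw [h3, hR2]
    field_simp
  rw [← Real.exp_add, h2, Real.exp_neg, Real.exp_log (by positivity)]
  refine le_of_eq ?_
  field_simp

/-- The martingale term is of the order of the regret bound, because a class with a separator of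
size `X` satisfies `ln B ≤ X A`. Here `L = ln B` and `V = (X³ ln B)^{1/4}`. -/
lemma sqrt_log_le {B : ℝ} (hδ : 0 < δ) (hδ1 : δ ≤ 1) (hN : 1 ≤ N) (hA : 1 ≤ A) (hX : 1 ≤ X)
    (hB : 2 ≤ B) (hL : L = Real.log B) (hLA : L ≤ X * A) (hV : 0 ≤ V) (hV4 : V ^ 4 = X ^ 3 * L) :
    √(8 * N * Real.log (2 * B / δ)) ≤ 4 * (√(N * A * Real.log (Real.exp 1 / δ)) * V) := by
  have hlog : Real.log (Real.exp 1 / δ) = 1 - Real.log δ := by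
    rw [Real.log_div (Real.exp_pos 1).ne' hδ.ne', Real.log_exp]
  have hlδ : Real.log δ ≤ 0 := Real.log_nonpos hδ.le hδ1
  have hlogB : Real.log (2 * B / δ) = Real.log 2 + L - Real.log δ := by
    rw [Real.log_div (by positivity) hδ.ne', Real.log_mul two_ne_zero (by positivity), hL]
  have hL2 : Real.log 2 ≤ L := hL ▸ Real.log_le_log two_pos hB
  have h2 : 0.6931471803 < Real.log 2 := Real.log_two_gt_d9
  have hAV : L ≤ A * V ^ 2 := by
    refine le_of_sq_le_sq ?_ (by positivity)
    calc L ^ 2 = L * L := sq L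
      _ ≤ X * A * L := mul_le_mul_of_nonneg_right hLA (by linarith)
      _ ≤ X ^ 3 * A ^ 2 * L := by
          refine mul_le_mul_of_nonneg_right ?_ (by linarith)
          exact mul_le_mul (le_self_pow₀ hX (by norm_num)) (le_self_pow₀ hA (by norm_num))
            (by linarith) (by positivity)
      _ = (A * V ^ 2) ^ 2 := by
          have : (A * V ^ 2) ^ 2 = A ^ 2 * V ^ 4 := by ring
          rw [this, hV4]
          ring
  rw [Real.sqrt_le_iff]
  refine ⟨by positivity, ?_⟩
  rw [mul_pow, mul_pow, hlog, hlogB, Real.sq_sqrt (mul_nonneg (by positivity) (by linarith))]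
  have h3 : Real.log 2 + L - Real.log δ ≤ 2 * (A * V ^ 2) * (1 - Real.log δ) := by
    nlinarith
  have h4 := mul_le_mul_of_nonneg_left h3 (by positivity : 0 ≤ 8 * N)
  linarith

/-- The sampling error: this is what the number `T` of oracle calls per round is chosen for. -/
lemma sampling_term_le (hμ : 0 < μ) (hδ : 0 < δ) (hN : 1 ≤ N) (hA : 1 ≤ A)
    (hS : 1 ≤ S) (hV : 0 < V) (hT : N * Real.log (6 * N * S / δ) / V ^ 2 ≤ T) (hT0 : 0 < T) :
    N * (μ * √(2 * Real.log (2 * N * S / δ) / T)) ≤ 2 * (μ * √(N * A) * V) := by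
  have hNS : 1 ≤ N * S := one_le_mul_of_one_le_of_one_le hN hS
  have h1 : Real.log (2 * N * S / δ) ≤ Real.log (6 * N * S / δ) := by
    refine Real.log_le_log (by positivity) ?_
    gcongr
    norm_num
  have h2 : Real.log (2 * N * S / δ) / T ≤ V ^ 2 / N := by
    rw [div_le_iff₀ (by positivity)] at hT
    rw [div_le_div_iff₀ hT0 (by positivity)]
    have := mul_le_mul_of_nonneg_left h1 (by positivity : 0 ≤ N)
    linarith
  have h3 : √(2 * Real.log (2 * N * S / δ) / T) ≤ 2 * (√(N * A) * V) / N := by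
    rw [Real.sqrt_le_iff]
    refine ⟨by positivity, ?_⟩
    rw [div_pow, mul_pow, mul_pow, Real.sq_sqrt (by positivity)]
    calc 2 * Real.log (2 * N * S / δ) / T = 2 * (Real.log (2 * N * S / δ) / T) := by ring
      _ ≤ 2 * (V ^ 2 / N) := by linarith
      _ ≤ 4 * A * (V ^ 2 / N) := mul_le_mul_of_nonneg_right (by linarith) (by positivity)
      _ = _ := by field_simp; ring
  calc N * (μ * √(2 * Real.log (2 * N * S / δ) / T)) ≤ N * (μ * (2 * (√(N * A) * V) / N)) := by
        gcongr
    _ = _ := by field_simp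

/-- The learning rate balances the stability term and the perturbation term. Here
`q = (ln B / X)^{1/4}`. -/
lemma leader_terms_le (hμ : 0 < μ) (hN : 1 ≤ N) (hA : 1 ≤ A) (hX : 1 ≤ X) (hq : 0 < q)
    (hq4 : q ^ 4 = L / X) (hη : η = 1 / (μ * √(N * A)) * q) :
    N * (4 * η * μ ^ 2 * X * A) + 1 / η * √(2 * X * L) ≤ 6 * (μ * √(N * A) * (X * q)) := by
  have hr : 0 < √(N * A) := Real.sqrt_pos.2 (by positivity)
  have hr2 : √(N * A) ^ 2 = N * A := Real.sq_sqrt (by positivity)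
  have h1 : N * (4 * η * μ ^ 2 * X * A) = 4 * (μ * √(N * A) * (X * q)) := by
    have : N * (4 * η * μ ^ 2 * X * A) = 4 * η * μ ^ 2 * X * √(N * A) ^ 2 := by
      rw [hr2]
      ring
    rw [this, hη]
    field_simp
  have h2 : √(2 * X * L) ≤ 2 * (X * q ^ 2) := by
    have hL : L = q ^ 4 * X := by
      rw [hq4]
      field_simp
    rw [Real.sqrt_le_iff]
    refine ⟨by positivity, ?_⟩
    have : 0 ≤ X ^ 2 * q ^ 4 := by positivity
    rw [hL]
    linarith
  have h3 : 1 / η * √(2 * X * L) ≤ 2 * (μ * √(N * A) * (X * q)) := by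
    have : 1 / η = μ * √(N * A) / q := by
      rw [hη]
      field_simp
    rw [this]
    calc μ * √(N * A) / q * √(2 * X * L) ≤ μ * √(N * A) / q * (2 * (X * q ^ 2)) := by gcongr
      _ = _ := by field_simp
  linarith

end Parameters

end COIL

end

theorem theorem3 :
    ∃ C : ℝ, 0 < C ∧
      ∀ (S A : Type*) [Fintype S] [Fintype A] [DecidableEq A]
        (M : COIL.LayeredMDP S A) (πE : S → A) (μ : ℝ) (ζ : S → A → ℝ)
        (Bc : Finset (S → A)) (hB : 2 ≤ Bc.card) (hBc : Bc.Nonempty) (Xc : Finset S)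
        (O : COIL.CSCOracle Bc) (N : ℕ) (δ : ℝ) (η : ℝ) (T : ℕ) [NeZero T],
        0 < μ →
        M.Recoverable (COIL.detPolicy πE) μ →
        COIL.ValidFeedback M πE μ ζ →
        COIL.IsSeparator Bc Xc →
        1 ≤ N →
        0 < δ → δ ≤ 1 →
        η = COIL.learningRate μ N (Fintype.card A) Xc.card Bc.card →
        T = COIL.sparsification N (Fintype.card S) Xc.card Bc.card (δ / 3) →
        -- with probability at least `1 - δ` the static regret is small
        ENNReal.ofReal (1 - δ) ≤
            COIL.loggerMProb M ζ O Xc η 1 T N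
              {r | M.staticRegret ζ Bc hBc (fun n => COIL.mixedPolicy (r.1 n)) ≤
                C * (μ * √((N : ℝ) * (Fintype.card A : ℝ) * Real.log (Real.exp 1 / δ)) *
                  ((Xc.card : ℝ) ^ 3 * Real.log (Bc.card : ℝ)) ^ (1 / 4 : ℝ))} ∧
          -- in every possible run, the numbers of annotations and of oracle calls
          ∀ (l : Fin N → COIL.Perturbation A Xc T),
            ∀ r ∈ (COIL.loggerM M ζ O Xc η 1 T N l).support,
              r.2.annotations = N ∧
              r.2.oracleCalls =
                N * ⌈(N : ℝ) * Real.log (6 * N * (Fintype.card S : ℝ) / δ) /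
                  √((Xc.card : ℝ) ^ 3 * Real.log (Bc.card : ℝ))⌉₊ := by
  refine ⟨12, by norm_num, ?_⟩
  intro S A _ _ _ M πE μ ζ Bc hB hBc Xc O N δ η T _ hμ hrec hval hsep hN hδ hδ1 hη hT
  have hTsp : COIL.sparsification N (Fintype.card S) Xc.card Bc.card (δ / 3) =
      ⌈(N : ℝ) * Real.log (6 * N * (Fintype.card S : ℝ) / δ) /
        √((Xc.card : ℝ) ^ 3 * Real.log (Bc.card : ℝ))⌉₊ := by
    have : 2 * (N : ℝ) * (Fintype.card S : ℝ) / (δ / 3) = 6 * N * (Fintype.card S : ℝ) / δ := by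
      field_simp
      ring
    rw [COIL.sparsification, this]
  refine ⟨?_, fun l r hr => ?_⟩
  · -- two distinct policies differ at a state of the separator, so that `X` and `S` are positive
    obtain ⟨h₁, hh₁, h₂, hh₂, hne⟩ := Finset.one_lt_card.1 hB
    obtain ⟨x, hx, -⟩ := hsep h₁ hh₁ h₂ hh₂ hne
    have hXc : 0 < Xc.card := Finset.card_pos.2 ⟨x, hx⟩
    have hX1 : (1 : ℝ) ≤ Xc.card := by exact_mod_cast hXc
    have hS1 : (1 : ℝ) ≤ Fintype.card S := by exact_mod_cast Fintype.card_pos_iff.2 ⟨x⟩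
    have hA1 : (1 : ℝ) ≤ Fintype.card A := by exact_mod_cast Fintype.card_pos_iff.2 ⟨h₁ x⟩
    have hN1 : (1 : ℝ) ≤ N := by exact_mod_cast hN
    have hB2 : (2 : ℝ) ≤ Bc.card := by exact_mod_cast hB
    have hT0 : (0 : ℝ) < T := Nat.cast_pos.2 (NeZero.pos T)
    have hL0 : 0 < Real.log (Bc.card : ℝ) := Real.log_pos (by linarith)
    have hLA : Real.log (Bc.card : ℝ) ≤ Xc.card * Fintype.card A := by
      have h1 : (Bc.card : ℝ) ≤ (Fintype.card A : ℝ) ^ Xc.card := by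
        exact_mod_cast COIL.card_le_pow_of_isSeparator hsep
      refine (Real.log_le_log (by linarith) h1).trans ?_
      rw [Real.log_pow]
      exact mul_le_mul_of_nonneg_left (Real.log_le_self (by linarith)) (Nat.cast_nonneg _)
    set q : ℝ := (Real.log (Bc.card : ℝ) / Xc.card) ^ (1 / 4 : ℝ) with hq
    have hq0 : 0 < q := Real.rpow_pos_of_pos (by positivity) _
    have hq4 : q ^ 4 = Real.log (Bc.card : ℝ) / Xc.card := by
      rw [hq, ← Real.rpow_natCast, ← Real.rpow_mul (by positivity)]
      norm_num
    set V : ℝ := ((Xc.card : ℝ) ^ 3 * Real.log (Bc.card : ℝ)) ^ (1 / 4 : ℝ) with hV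
    have hV0 : 0 < V := Real.rpow_pos_of_pos (by positivity) _
    have hV4 : V ^ 4 = (Xc.card : ℝ) ^ 3 * Real.log (Bc.card : ℝ) := by
      rw [hV, ← Real.rpow_natCast, ← Real.rpow_mul (by positivity)]
      norm_num
    have hV2 : √((Xc.card : ℝ) ^ 3 * Real.log (Bc.card : ℝ)) = V ^ 2 := by
      rw [← hV4, show V ^ 4 = (V ^ 2) ^ 2 by ring, Real.sqrt_sq (by positivity)]
    have hVq : V = Xc.card * q := by
      refine (pow_left_inj₀ hV0.le (by positivity) (by norm_num : 4 ≠ 0)).1 ?_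
      rw [hV4, mul_pow, hq4]
      field_simp
    have hη0 : 0 < η := by
      rw [hη, COIL.learningRate]
      positivity
    have hTV : (N : ℝ) * Real.log (6 * N * (Fintype.card S : ℝ) / δ) / V ^ 2 ≤ T := by
      rw [hT, hTsp, hV2]
      exact Nat.le_ceil _
    have hζ : ∀ s a, |ζ s a| ≤ μ := COIL.abs_le_of_validFeedback hμ hrec hval
    set ε : ℝ := μ * √(2 * Real.log (2 * N * Fintype.card S / δ) / T) with hε
    set R : ℝ := μ * √(8 * N * Real.log (2 * Bc.card / δ)) with hR
    have hlogB : 0 < Real.log (2 * Bc.card / δ) := by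
      refine Real.log_pos ?_
      rw [lt_div_iff₀ hδ]
      linarith
    have hR0 : 0 < R := mul_pos hμ (Real.sqrt_pos.2 (by positivity))
    have hprob := COIL.one_le_prob_regret M O T hη0 hsep hμ hζ (ε := ε)
      (t := R / (4 * N * μ ^ 2)) (by positivity) (by positivity) R N
    have hbound : R + (N * (ε + 4 * η * μ ^ 2 * Xc.card * Fintype.card A) -
        COIL.potential ζ O Xc η []) ≤
        12 * (μ * √((N : ℝ) * (Fintype.card A : ℝ) * Real.log (Real.exp 1 / δ)) * V) := by
      have b1 := mul_le_mul_of_nonneg_left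
        (COIL.sqrt_log_le hδ hδ1 hN1 hA1 hX1 hB2 rfl hLA hV0.le hV4) hμ.le
      have b2 := COIL.sampling_term_le hμ hδ hN1 hA1 hS1 hV0 hTV hT0
      have b3 := COIL.leader_terms_le hμ hN1 hA1 hX1 hq0 hq4 hη
      have b4 := COIL.neg_potential_nil_le (ζ := ζ) (O := O) hη0 hsep hB hXc
      have b5 : √((N : ℝ) * Fintype.card A) ≤
          √((N : ℝ) * Fintype.card A * Real.log (Real.exp 1 / δ)) := by
        refine Real.sqrt_le_sqrt (le_mul_of_one_le_right (by positivity) ?_)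
        rw [Real.le_log_iff_exp_le (by positivity), le_div_iff₀ hδ]
        exact mul_le_of_le_one_right (Real.exp_pos 1).le hδ1
      have b6 := mul_le_mul_of_nonneg_right (mul_le_mul_of_nonneg_left b5 hμ.le) hV0.le
      rw [← hVq] at b3
      linarith
    have hsum : ENNReal.ofReal (N * (Fintype.card S * Real.exp (-(T * ε ^ 2 / (2 * μ ^ 2))))) +
        ENNReal.ofReal (Bc.card * (Real.exp (-(R / (4 * N * μ ^ 2) * R)) *
          Real.exp (N * (2 * (R / (4 * N * μ ^ 2)) ^ 2 * μ ^ 2)))) ≤ ENNReal.ofReal δ := by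
      rw [show δ = δ / 2 + δ / 2 by ring, ENNReal.ofReal_add (by positivity) (by positivity)]
      exact add_le_add
        (ENNReal.ofReal_le_ofReal (COIL.prob_badSample_le hμ hδ hδ1 hN1 hS1 hT0))
        (ENNReal.ofReal_le_ofReal (COIL.prob_deviation_le hμ hδ hδ1 hN1 hB2 hR rfl))
    have hprob' := hprob.trans (add_le_add_right hsum _)
    rw [ENNReal.ofReal_sub _ hδ.le, ENNReal.ofReal_one]
    refine (tsub_le_iff_right.2 hprob').trans ?_
    have hint := (COIL.lintegral_logger (ζ := ζ) M O T hη0 hsep N [] ⟨0, 0⟩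
      {us | M.staticRegret ζ Bc hBc (fun n => COIL.mixedPolicy (us n)) ≤
        12 * (μ * √((N : ℝ) * (Fintype.card A : ℝ) * Real.log (Real.exp 1 / δ)) * V)}).2
    refine le_trans ?_ hint.ge
    refine MeasureTheory.OuterMeasure.mono _ fun z hz => ?_
    simp only [Set.mem_ofPred_eq] at hz ⊢
    rw [COIL.LayeredMDP.staticRegret, sub_le_comm, Finset.le_inf'_iff]
    intro h hh
    have h1 := (hz h hh).trans hbound
    simp only [COIL.roundRegret, Finset.sum_sub_distrib] at h1
    linarith
  · obtain ⟨h1, h2⟩ := COIL.usage_of_mem_support M ζ O Xc η T N l [] ⟨0, 0⟩ r hr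
    rw [← hTsp, ← hT]
    exact ⟨h1.trans (zero_add _), h2.trans (zero_add _)⟩
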